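/- A knot diagram is a closed curve in the plane whose only singularities are finitely many transversal double points (the crossings), together with, at each crossing, the information which of the two branches goes under. Cutting the curve at its under-passages yields the arcs; if the diagram has $n\ge 1$ crossings, it has $n$ arcs. Going along the diagram, in either direction, from some reference point, enumerate the crossings in the order in which one passes under them, and let the $i$-th arc be the one that stems from the $i$-th crossing. The corresponding coloring matrix of the diagram is the $n\times n$ integer matrix whose $i$-th row holds the coefficients of the equation $x+y-2z=0$, where $x,y$ are the variables of the two under-arcs and $z$ is the variable of the over-arc at the $i$-th crossing (coefficients being added up when some of these arcs coincide). For a diagram without crossings, which has a single arc and no equation, the coloring matrix is by convention the $1\times 1$ zero matrix. An elementary transformation of an integer matrix is a finite sequence of the following operations and their inverses: (1) a permutation of the rows or of the columns; (2) the replacement of $M$ by $\begin{pmatrix} M & 0\\ 0 & 1\end{pmatrix}$; (3) the addition of an integer multiple of a row (column) to another row (column). Proposition. Let the knot diagram $D'$ be obtained from the knot diagram $D$ by a finite sequence of Reidemeister moves of type I, II and III (each in either direction). Then every coloring matrix of $D'$ is obtained from every coloring matrix of $D$ by a finite sequence of elementary transformations. -/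

import Mathlib

open scoped Topology

/-! ### Knot diagrams -/

/-- The plane on which diagrams are drawn. -/
abbrev Plane : Type := EuclideanSpace ℝ (Fin 2)

/-- For a closed curve, parametrized by `ℝ` with period one: the parameters `s` and `t` belong to
different points of the circle `ℝ / ℤ` but are sent to the same point of the plane. -/
def CrossAt (γ : ℝ → Plane) (s t : ℝ) : Prop :=
  γ s = γ t ∧ ∀ m : ℤ, s ≠ t + m

/-- A knot diagram: a closed curve in the plane, parametrized by `ℝ` with period one, whose only
singularities are finitely many transversal double points, with, at each of these crossings,
the information which of the two branches goes under. No differentiability is required, so that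
smooth and polygonal diagrams are both covered. -/
structure KnotDiagram where
  /-- The closed curve which is the projection of the knot. -/
  curve : ℝ → Plane
  continuous_curve : Continuous curve
  periodic_curve : Function.Periodic curve 1
  /-- There are finitely many crossings. -/
  finite_crossings : {t : ℝ | t ∈ Set.Ico (0 : ℝ) 1 ∧ ∃ s, CrossAt curve s t}.Finite
  /-- No point of the plane is passed more than twice. -/
  no_triple : ∀ r s t : ℝ, CrossAt curve r s → CrossAt curve r t → ∃ m : ℤ, s = t + m
  /-- At a crossing the two branches meet transversally: in suitable local coordinates of the plane
  one branch runs in the first coordinate axis and the other one in the second axis. -/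
  transversal : ∀ s t : ℝ, CrossAt curve s t →
    ∃ e : OpenPartialHomeomorph Plane (ℝ × ℝ), curve s ∈ e.source ∧ e (curve s) = (0, 0) ∧
      (∀ᶠ r in 𝓝 s, (e (curve r)).2 = 0) ∧ (∀ᶠ r in 𝓝 t, (e (curve r)).1 = 0)
  /-- The parameters at which the curve goes under at a crossing. -/
  under : Set ℝ
  under_crossing : ∀ t ∈ under, ∃ s, CrossAt curve s t
  /-- At each crossing exactly one of the two branches goes under. -/
  under_iff : ∀ s t : ℝ, CrossAt curve s t → (s ∈ under ↔ t ∉ under)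

namespace KnotDiagram

/-- The parameters `s` and `t` are the two passages through one crossing of the diagram. -/
def Cross (D : KnotDiagram) (s t : ℝ) : Prop := CrossAt D.curve s t

/-! ### Coloring matrices -/

/-- `τ 0 < τ 1 < … < τ (n - 1)` are the times in `[0, 1)` at which one passes under at a crossing
when going along the diagram from the reference point with parameter `p`, in the direction of
the parametrization if `ε = 1` and in the opposite direction if `ε = -1`. -/
structure IsTraversal (D : KnotDiagram) (p ε : ℝ) {n : ℕ} (τ : Fin n → ℝ) : Prop where
  direction : ε = 1 ∨ ε = -1
  strictMono : StrictMono τ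
  mem_Ico : ∀ i, τ i ∈ Set.Ico (0 : ℝ) 1
  under_iff : ∀ t ∈ Set.Ico (0 : ℝ) 1, p + ε * t ∈ D.under ↔ ∃ i, τ i = t

/-- The time at which the `k`-th arc, which starts at time `τ k`, ends: the next passage under a
crossing. The last arc ends at the first crossing, one turn later. -/
noncomputable def arcEnd {n : ℕ} (τ : Fin n → ℝ) (k : Fin n) : ℝ :=
  if k < finRotate n k then τ (finRotate n k) else τ (finRotate n k) + 1

/-- The point with parameter `s` lies on the `k`-th arc of the traversal. -/
def OnArc (p ε : ℝ) {n : ℕ} (τ : Fin n → ℝ) (k : Fin n) (s : ℝ) : Prop :=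
  ∃ t ∈ Set.Ioo (τ k) (arcEnd τ k), ∃ m : ℤ, s = p + ε * t + m

/-- `M` is a coloring matrix of the diagram `D`. The crossings and the arcs are enumerated going
along the diagram from some reference point in one of the two directions, the `i`-th arc stemming
from the `i`-th crossing; `ov i` is the index of the over-arc at the `i`-th crossing. Row `i` holds
the coefficients of the equation `(sum of the two under-arcs) - 2 (over-arc) = 0` of crossing `i`;
its under-arcs are the arc `i` and the arc `j` that ends there (`finRotate n j = i`), and
coefficients of arcs that coincide are added up.
A diagram without crossings has one arc and no equation; its coloring matrix is by convention the
one-by-one zero matrix. -/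
def IsColoringMatrix (D : KnotDiagram) {n : ℕ} (M : Matrix (Fin n) (Fin n) ℤ) : Prop :=
  (D.under = ∅ ∧ n = 1 ∧ M = 0) ∨
  (0 < n ∧ ∃ (p ε : ℝ) (τ : Fin n → ℝ) (ov : Fin n → Fin n),
    D.IsTraversal p ε τ ∧
    (∀ i, ∃ s, D.Cross s (p + ε * τ i) ∧ OnArc p ε τ (ov i) s) ∧
    ∀ i j, M i j =
      (if j = i then 1 else 0) + (if finRotate n j = i then 1 else 0)
        - 2 * (if j = ov i then 1 else 0))

/-! ### Reidemeister moves -/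

/-- The diagram `D` meets the closed set `B` in exactly `k` strands, parametrized by the pairwise
disjoint intervals `[a i, b i]` of the circle `ℝ / ℤ`. Each strand runs in the interior of `B`
except for its endpoints on the frontier of `B`, and there is no crossing on the frontier. -/
structure MeetsInStrands (D : KnotDiagram) (B : Set Plane) {k : ℕ} (a b : Fin k → ℝ) : Prop where
  lt : ∀ i, a i < b i
  disjoint : ∀ i j, ∀ s ∈ Set.Icc (a i) (b i), ∀ t ∈ Set.Icc (a j) (b j), ∀ m : ℤ,
    s = t + m → i = j ∧ s = t
  mem_iff : ∀ t, D.curve t ∈ B ↔ ∃ i, ∃ m : ℤ, t + m ∈ Set.Icc (a i) (b i)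
  mem_interior : ∀ i, ∀ t ∈ Set.Ioo (a i) (b i), D.curve t ∈ interior B
  left_mem_frontier : ∀ i, D.curve (a i) ∈ frontier B
  right_mem_frontier : ∀ i, D.curve (b i) ∈ frontier B
  no_cross_frontier : ∀ s t, D.Cross s t → D.curve s ∉ frontier B

/-- The set `B` is a closed topological disc in the plane, both diagrams meet it in `k` strands, with
the same parameter intervals `[a i, b i]`, and the diagrams, with their crossings, are the same
outside the interior of `B`. -/
structure LocalChange (D D' : KnotDiagram) (B : Set Plane) {k : ℕ} (a b : Fin k → ℝ) : Prop where
  isDisc : ∃ h : Plane ≃ₜ Plane, B = h '' Metric.closedBall 0 1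
  strands : D.MeetsInStrands B a b
  strands' : D'.MeetsInStrands B a b
  curve_eq : ∀ t, D.curve t ∉ interior B → D'.curve t = D.curve t
  under_iff : ∀ t, D.curve t ∉ interior B → (t ∈ D'.under ↔ t ∈ D.under)

/-- Type I Reidemeister move, in the direction that creates a crossing: in a disc which the diagram
meets in one strand without crossings, this strand is replaced by one that crosses itself exactly
once. -/
def ReidemeisterI (D D' : KnotDiagram) : Prop :=
  ∃ (B : Set Plane) (a b : Fin 1 → ℝ), LocalChange D D' B a b ∧
    (∀ s ∈ Set.Icc (a 0) (b 0), ∀ t ∈ Set.Icc (a 0) (b 0), ¬ D.Cross s t) ∧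
    ∃! q : ℝ × ℝ, q.1 ∈ Set.Icc (a 0) (b 0) ∧ q.2 ∈ Set.Icc (a 0) (b 0) ∧ q.1 < q.2 ∧
      D'.Cross q.1 q.2

/-- Type II Reidemeister move, in the direction that creates crossings: in a disc which the diagram
meets in two strands without crossings, the strands are replaced by two strands without
self-crossings which cross each other exactly twice, the strand `0` going over the strand `1`
both times. -/
def ReidemeisterII (D D' : KnotDiagram) : Prop :=
  ∃ (B : Set Plane) (a b : Fin 2 → ℝ), LocalChange D D' B a b ∧
    (∀ i j, ∀ s ∈ Set.Icc (a i) (b i), ∀ t ∈ Set.Icc (a j) (b j), ¬ D.Cross s t) ∧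
    (∀ i, ∀ s ∈ Set.Icc (a i) (b i), ∀ t ∈ Set.Icc (a i) (b i), ¬ D'.Cross s t) ∧
    {q : ℝ × ℝ | q.1 ∈ Set.Icc (a 0) (b 0) ∧ q.2 ∈ Set.Icc (a 1) (b 1) ∧
      D'.Cross q.1 q.2}.ncard = 2 ∧
    ∀ s ∈ Set.Icc (a 0) (b 0), s ∉ D'.under

/-- The three strands with parameter intervals `[a i, b i]` have no self-crossings and any two of
them cross exactly once; `x i j` is the parameter on the strand `i` of its crossing with the strand
`j`. The strand `0` goes over the strands `1` and `2`, and the strand `1` over the strand `2`. -/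
structure ThreeStrands (D : KnotDiagram) (a b : Fin 3 → ℝ) (x : Fin 3 → Fin 3 → ℝ) : Prop where
  mem : ∀ i j, i ≠ j → x i j ∈ Set.Icc (a i) (b i)
  cross : ∀ i j, i ≠ j → D.Cross (x i j) (x j i)
  eq_of_cross : ∀ i j, ∀ s ∈ Set.Icc (a i) (b i), ∀ t ∈ Set.Icc (a j) (b j), D.Cross s t →
    i ≠ j ∧ s = x i j ∧ t = x j i
  under : ∀ i j, i < j → x j i ∈ D.under

/-- Type III Reidemeister move: in a disc which the diagram meets in three strands, any two of which
cross once, a top, a middle and a bottom one, these are replaced by three such strands which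
meet each other in the reversed order (the triangle is turned over). -/
def ReidemeisterIII (D D' : KnotDiagram) : Prop :=
  ∃ (B : Set Plane) (a b : Fin 3 → ℝ) (x y : Fin 3 → Fin 3 → ℝ), LocalChange D D' B a b ∧
    D.ThreeStrands a b x ∧ D'.ThreeStrands a b y ∧
    ∀ i j k, i ≠ j → i ≠ k → j ≠ k → (x i j < x i k ↔ y i k < y i j)

/-- A Reidemeister move of type I, II or III, in either direction, leads from `D` to `D'`. -/
def ReidemeisterMove (D D' : KnotDiagram) : Prop :=
  ReidemeisterI D D' ∨ ReidemeisterI D' D ∨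
  ReidemeisterII D D' ∨ ReidemeisterII D' D ∨
  ReidemeisterIII D D' ∨ ReidemeisterIII D' D

end KnotDiagram

/-! ### Elementary transformations of integer matrices -/

/-- Integer matrices of all sizes. -/
abbrev IntMatrix : Type := Σ d : ℕ × ℕ, Matrix (Fin d.1) (Fin d.2) ℤ

/-- The block matrix with diagonal blocks `M` and `1`. -/
def adjoinOne {m n : ℕ} (M : Matrix (Fin m) (Fin n) ℤ) :
    Matrix (Fin (m + 1)) (Fin (n + 1)) ℤ :=
  (Matrix.fromBlocks M 0 0 (1 : Matrix (Fin 1) (Fin 1) ℤ)).reindex finSumFinEquiv finSumFinEquiv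

/-- One operation: permuting rows or columns, adjoining a `1` in a direct sum, or adding a multiple
of a row or column to another one. -/
inductive ElementaryStep : IntMatrix → IntMatrix → Prop
  | permRows {m n : ℕ} (M : Matrix (Fin m) (Fin n) ℤ) (σ : Equiv.Perm (Fin m)) :
      ElementaryStep ⟨(m, n), M⟩ ⟨(m, n), M.submatrix σ id⟩
  | permCols {m n : ℕ} (M : Matrix (Fin m) (Fin n) ℤ) (σ : Equiv.Perm (Fin n)) :
      ElementaryStep ⟨(m, n), M⟩ ⟨(m, n), M.submatrix id σ⟩
  | adjoin {m n : ℕ} (M : Matrix (Fin m) (Fin n) ℤ) :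
      ElementaryStep ⟨(m, n), M⟩ ⟨(m + 1, n + 1), adjoinOne M⟩
  | addRow {m n : ℕ} (M : Matrix (Fin m) (Fin n) ℤ) (i j : Fin m) (c : ℤ) (hij : i ≠ j) :
      ElementaryStep ⟨(m, n), M⟩ ⟨(m, n), M.updateRow j (fun l => M j l + c * M i l)⟩
  | addCol {m n : ℕ} (M : Matrix (Fin m) (Fin n) ℤ) (i j : Fin n) (c : ℤ) (hij : i ≠ j) :
      ElementaryStep ⟨(m, n), M⟩ ⟨(m, n), M.updateCol j (fun l => M l j + c * M l i)⟩

/-- `N` is obtained from `M` by a finite sequence of the operations and their inverses. -/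
def ElementarilyEquivalent {m n m' n' : ℕ} (M : Matrix (Fin m) (Fin n) ℤ)
    (N : Matrix (Fin m') (Fin n') ℤ) : Prop :=
  Relation.EqvGen ElementaryStep ⟨(m, n), M⟩ ⟨(m', n'), N⟩

/-! The argument replaces coloring matrices by a more flexible family. The curve may be cut at any
finite nonempty set of points that contains all under-passages (`IsCutSystem`). Each cut gives one
arc and one row of `cutMatrix`: `x + y - 2z` at an under-passage, and `x - y` at a superfluous cut,
where the arcs before and after it must have the same color. A superfluous cut is eliminated by a
Schur complement at an entry `1` (`MatEquiv.schur`, `matEquiv_cutMatrix_removeCut`), so all cut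
matrices of one diagram are equivalent (`matEquiv_cutMatrix`). Every coloring matrix is a cut matrix
up to a permutation of the columns (`IsColoringMatrix.exists_cutSystem`). This settles the choice of
reference point and direction, and also the diagrams without crossings.

For a Reidemeister move, superfluous cuts are placed so that the matrices of both diagrams have the
same index set. The rows of crossings outside the disc then coincide (`LocalChange.cutMatrix_inl`),
because the arc containing a point depends only on the cyclic order of the cuts. The few rows inside
the disc are matched by hand: for type I they agree up to sign; for types II and III an arc `e`
inside the disc occurs in no outer row (`LocalChange.cutMatrix_inl_inr`), so a linear substitution
for the variable of `e`, that is, a column operation, changes only inner rows (`MatEquiv.of_typeII`,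
`MatEquiv.of_typeIII`). -/

/-! ### Elementary equivalence over arbitrary finite index types -/

/-- Elementary equivalence of matrices over arbitrary finite index types, after enumerating them. -/
def MatEquiv {ι κ ι' κ' : Type} (M : Matrix ι κ ℤ) (N : Matrix ι' κ' ℤ) : Prop :=
  ∃ (m n m' n' : ℕ) (e : ι ≃ Fin m) (f : κ ≃ Fin n) (e' : ι' ≃ Fin m') (f' : κ' ≃ Fin n'),
    ElementarilyEquivalent (M.submatrix e.symm f.symm) (N.submatrix e'.symm f'.symm)

/-- The block matrix with diagonal blocks `1` and `M`, indexed by `Option` types. -/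
def adjoinNone {ι κ : Type} (M : Matrix ι κ ℤ) : Matrix (Option ι) (Option κ) ℤ
  | none, none => 1
  | none, some _ => 0
  | some _, none => 0
  | some i, some j => M i j

namespace ElementarilyEquivalent

theorem refl {m n : ℕ} (M : Matrix (Fin m) (Fin n) ℤ) : ElementarilyEquivalent M M :=
  Relation.EqvGen.refl _

theorem symm {m n m' n' : ℕ} {M : Matrix (Fin m) (Fin n) ℤ} {N : Matrix (Fin m') (Fin n') ℤ}
    (h : ElementarilyEquivalent M N) : ElementarilyEquivalent N M :=
  Relation.EqvGen.symm _ _ h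

theorem trans {m n m' n' m'' n'' : ℕ} {M : Matrix (Fin m) (Fin n) ℤ}
    {N : Matrix (Fin m') (Fin n') ℤ} {P : Matrix (Fin m'') (Fin n'') ℤ}
    (h : ElementarilyEquivalent M N) (h' : ElementarilyEquivalent N P) :
    ElementarilyEquivalent M P :=
  Relation.EqvGen.trans _ _ _ h h'

theorem submatrix {m n : ℕ} (M : Matrix (Fin m) (Fin n) ℤ) (σ : Equiv.Perm (Fin m))
    (τ : Equiv.Perm (Fin n)) : ElementarilyEquivalent M (M.submatrix σ τ) :=
  trans (Relation.EqvGen.rel _ _ (ElementaryStep.permRows M σ))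
    (Relation.EqvGen.rel _ _ (ElementaryStep.permCols (M.submatrix σ id) τ))

/-- Two enumerations of the index types give elementarily equivalent matrices. -/
theorem submatrix_submatrix {ι κ : Type} (M : Matrix ι κ ℤ) {m n m' n' : ℕ}
    (e : ι ≃ Fin m) (f : κ ≃ Fin n) (e' : ι ≃ Fin m') (f' : κ ≃ Fin n') :
    ElementarilyEquivalent (M.submatrix e.symm f.symm) (M.submatrix e'.symm f'.symm) := by
  obtain rfl : m = m' := by simpa using Fintype.card_congr (e.symm.trans e')
  obtain rfl : n = n' := by simpa using Fintype.card_congr (f.symm.trans f')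
  have h := submatrix (M.submatrix e.symm f.symm) (e'.symm.trans e) (f'.symm.trans f)
  convert h using 1
  ext i j
  simp

end ElementarilyEquivalent

namespace MatEquiv

theorem elementarilyEquivalent {m n m' n' : ℕ} {M : Matrix (Fin m) (Fin n) ℤ}
    {N : Matrix (Fin m') (Fin n') ℤ} (h : MatEquiv M N) : ElementarilyEquivalent M N := by
  obtain ⟨_, _, _, _, e, f, e', f', h⟩ := h
  exact (ElementarilyEquivalent.submatrix_submatrix M (Equiv.refl _) (Equiv.refl _) e f).trans
    (h.trans (ElementarilyEquivalent.submatrix_submatrix N e' f' (Equiv.refl _) (Equiv.refl _)))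

theorem symm {ι κ ι' κ' : Type} {M : Matrix ι κ ℤ} {N : Matrix ι' κ' ℤ}
    (h : MatEquiv M N) : MatEquiv N M := by
  obtain ⟨_, _, _, _, e, f, e', f', h⟩ := h
  exact ⟨_, _, _, _, e', f', e, f, h.symm⟩

theorem trans {ι κ ι' κ' ι'' κ'' : Type} {M : Matrix ι κ ℤ} {N : Matrix ι' κ' ℤ}
    {P : Matrix ι'' κ'' ℤ} (h : MatEquiv M N) (h' : MatEquiv N P) : MatEquiv M P := by
  obtain ⟨_, _, _, _, e, f, e₁, f₁, h⟩ := h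
  obtain ⟨_, _, _, _, e₂, f₂, e', f', h'⟩ := h'
  exact ⟨_, _, _, _, e, f, e', f',
    h.trans ((ElementarilyEquivalent.submatrix_submatrix N e₁ f₁ e₂ f₂).trans h')⟩

theorem congr_right {ι κ ι' κ' : Type} {M : Matrix ι κ ℤ} {N N' : Matrix ι' κ' ℤ}
    (h : MatEquiv M N) (hN : ∀ i j, N i j = N' i j) : MatEquiv M N' := by
  rwa [← Matrix.ext hN]

theorem submatrix {ι κ ι' κ' : Type} [Finite ι] [Finite κ] (M : Matrix ι κ ℤ) (e : ι' ≃ ι)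
    (f : κ' ≃ κ) : MatEquiv M (M.submatrix e f) := by
  obtain ⟨m, ⟨a⟩⟩ := Finite.exists_equiv_fin ι
  obtain ⟨n, ⟨b⟩⟩ := Finite.exists_equiv_fin κ
  refine ⟨m, n, m, n, a, b, e.trans a, f.trans b, ?_⟩
  convert ElementarilyEquivalent.refl (M.submatrix a.symm b.symm) using 1
  ext i j
  simp

theorem refl {ι κ : Type} [Finite ι] [Finite κ] (M : Matrix ι κ ℤ) : MatEquiv M M :=
  submatrix M (Equiv.refl ι) (Equiv.refl κ)

theorem addRow {ι κ : Type} [Finite ι] [Finite κ] [DecidableEq ι] (M : Matrix ι κ ℤ) {i j : ι}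
    (hij : i ≠ j) (c : ℤ) : MatEquiv M (M.updateRow j fun l => M j l + c * M i l) := by
  obtain ⟨m, ⟨a⟩⟩ := Finite.exists_equiv_fin ι
  obtain ⟨n, ⟨b⟩⟩ := Finite.exists_equiv_fin κ
  refine ⟨m, n, m, n, a, b, a, b, ?_⟩
  have h := Relation.EqvGen.rel _ _
    (ElementaryStep.addRow (M.submatrix a.symm b.symm) (a i) (a j) c (a.injective.ne hij))
  unfold ElementarilyEquivalent
  convert h using 3
  ext k l
  by_cases hk : k = a j
  · subst hk; simp
  · have : a.symm k ≠ j := fun h => hk (by simp [← h])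
    simp [Matrix.updateRow_apply, hk, this]

theorem adjoinNone {ι κ : Type} [Finite ι] [Finite κ] (M : Matrix ι κ ℤ) :
    MatEquiv M (adjoinNone M) := by
  obtain ⟨m, ⟨a⟩⟩ := Finite.exists_equiv_fin ι
  obtain ⟨n, ⟨b⟩⟩ := Finite.exists_equiv_fin κ
  refine ⟨m, n, m + 1, n + 1, a, b,
    -- `adjoinOne` puts the new row and column last, hence `none` is sent to the last index.
    (Equiv.optionCongr a).trans finSuccEquivLast.symm,
    (Equiv.optionCongr b).trans finSuccEquivLast.symm, ?_⟩
  have h := Relation.EqvGen.rel _ _ (ElementaryStep.adjoin (M.submatrix a.symm b.symm))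
  unfold ElementarilyEquivalent
  convert h using 3
  ext k l
  refine Fin.lastCases ?_ (fun k => ?_) k <;> refine Fin.lastCases ?_ (fun l => ?_) l
  · simp [adjoinOne, _root_.adjoinNone, finSumFinEquiv_symm_last]
    rfl
  · simp [adjoinOne, _root_.adjoinNone, finSumFinEquiv_symm_last]
    rfl
  · simp [adjoinOne, _root_.adjoinNone, finSumFinEquiv_symm_last]
    rfl
  · simp [adjoinOne, _root_.adjoinNone]
    rfl

/-- The list of operations is closed under transposition, so every column lemma below follows from
its row version. -/
theorem _root_.ElementarilyEquivalent.transpose {m n m' n' : ℕ} {M : Matrix (Fin m) (Fin n) ℤ}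
    {N : Matrix (Fin m') (Fin n') ℤ} (h : ElementarilyEquivalent M N) :
    ElementarilyEquivalent M.transpose N.transpose := by
  let T : IntMatrix → IntMatrix := fun X => ⟨(X.1.2, X.1.1), X.2.transpose⟩
  have key : ∀ X Y : IntMatrix, Relation.EqvGen ElementaryStep X Y →
      Relation.EqvGen ElementaryStep (T X) (T Y) := by
    intro X Y h
    induction h with
    | refl => exact .refl _
    | symm _ _ _ ih => exact .symm _ _ ih
    | trans _ _ _ _ _ ih₁ ih₂ => exact .trans _ _ _ ih₁ ih₂
    | rel _ _ h =>
      refine .rel _ _ ?_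
      cases h with
      | permRows M σ => exact .permCols M.transpose σ
      | permCols M σ => exact .permRows M.transpose σ
      | adjoin M =>
        have h : (adjoinOne M).transpose = adjoinOne M.transpose := by
          simp [adjoinOne, Matrix.reindex_apply, Matrix.transpose_submatrix,
            Matrix.fromBlocks_transpose]
        simp only [T, h]
        exact .adjoin M.transpose
      | addRow M i j c hij =>
        simp only [T, ← Matrix.updateCol_transpose]
        exact .addCol M.transpose i j c hij
      | addCol M i j c hij =>
        simp only [T, ← Matrix.updateRow_transpose]
        exact .addRow M.transpose i j c hij
  exact key _ _ h

theorem transpose {ι κ ι' κ' : Type} {M : Matrix ι κ ℤ} {N : Matrix ι' κ' ℤ}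
    (h : MatEquiv M N) : MatEquiv M.transpose N.transpose := by
  obtain ⟨_, _, _, _, e, f, e', f', h⟩ := h
  exact ⟨_, _, _, _, f, e, f', e', h.transpose⟩

/-- Multiples of one row may be added to all the other rows. -/
theorem addRows {ι κ : Type} [Finite ι] [Finite κ] (M : Matrix ι κ ℤ) (i₀ : ι)
    (v : ι → ℤ) (hv : v i₀ = 0) : MatEquiv M fun i j => M i j + v i * M i₀ j := by
  classical
  have := Fintype.ofFinite ι
  -- `S` is the set of rows already treated. Since `v i₀ = 0`, the row `i₀` that is being added
  -- stays the same throughout.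
  suffices h : ∀ S : Finset ι,
      MatEquiv M fun i j => M i j + (if i ∈ S then v i else 0) * M i₀ j by
    simpa using h Finset.univ
  intro S
  induction S using Finset.induction_on with
  | empty => simpa using refl M
  | insert a S ha ih =>
    by_cases h : a = i₀
    · refine ih.congr_right fun i j => ?_
      by_cases hi : i = a
      · subst hi; subst h; simp [hv]
      · simp [hi]
    · refine (ih.trans (addRow _ (Ne.symm h) (v a))).congr_right fun i j => ?_
      by_cases hi : i = a
      · subst hi; simp [Matrix.updateRow, ha, hv]
      · simp [Matrix.updateRow, hi]

/-- Multiples of one column may be added to all the other columns. -/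
theorem addCols {ι κ : Type} [Finite ι] [Finite κ] (M : Matrix ι κ ℤ) (j₀ : κ)
    (v : κ → ℤ) (hv : v j₀ = 0) : MatEquiv M fun i j => M i j + v j * M i j₀ :=
  (addRows M.transpose j₀ v hv).transpose

/-- Elimination of a row and a column which meet in an entry `1`. -/
theorem schur {ι : Type} [Finite ι] [DecidableEq ι] (M : Matrix ι ι ℤ) (i₀ : ι)
    (h : M i₀ i₀ = 1) :
    MatEquiv M fun i j : {i // i ≠ i₀} => M i j - M i i₀ * M i₀ j := by
  -- Row operations clear the rest of column `i₀`; after that, clearing row `i₀` by column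
  -- operations affects no other row. What remains is a block sum with `1`.
  have h₁ := addRows M i₀ (fun i => if i = i₀ then 0 else - M i i₀) (by simp)
  refine h₁.trans ((addCols _ i₀ (fun j => if j = i₀ then 0 else - M i₀ j) (by simp)).trans ?_)
  refine symm ((adjoinNone _).trans ((submatrix _ (Equiv.optionSubtypeNe i₀).symm
    (Equiv.optionSubtypeNe i₀).symm).congr_right fun i j => ?_))
  by_cases hi : i = i₀ <;> by_cases hj : j = i₀
  · subst hi; subst hj; simp [_root_.adjoinNone, h]
  · subst hi; simp [_root_.adjoinNone, h, hj]
  · subst hj; simp [_root_.adjoinNone, h, hi]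
  · simp [_root_.adjoinNone, h, hi, hj]
    ring

/-- A sign change is not among the elementary operations; it is obtained with the help of an
adjoined `1`. -/
theorem negRow {ι κ : Type} [Finite ι] [Finite κ] [DecidableEq ι] (M : Matrix ι κ ℤ) (r : ι) :
    MatEquiv M fun i j => if i = r then - M i j else M i j := by
  refine (adjoinNone M).trans (symm ((adjoinNone _).trans (symm ?_)))
  have h : some r ≠ none := Option.some_ne_none r
  -- With `e` the adjoined row, the pair `(r, e)` becomes `(r + e, e)`, `(r + e, -r)`, `(e, -r)`,
  -- and the swap gives `(-r, e)`.
  refine (addRow _ h.symm 1).trans ((addRow _ h (-1)).trans ((addRow _ h.symm 1).trans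
    ((submatrix _ (Equiv.swap (some r) none) (Equiv.refl _)).congr_right fun i j => ?_)))
  rcases i with _ | i
  · cases j <;> simp [_root_.adjoinNone, Matrix.updateRow_apply]
  · by_cases hi : i = r
    · subst hi
      cases j <;> simp [_root_.adjoinNone, Matrix.updateRow_apply]
    · have : Equiv.swap (some r) none (some i) = some i :=
        Equiv.swap_apply_of_ne_of_ne (by simpa using hi) (by simp)
      cases j <;> simp [_root_.adjoinNone, Matrix.updateRow_apply, hi, this]

theorem negCol {ι κ : Type} [Finite ι] [Finite κ] [DecidableEq κ] (M : Matrix ι κ ℤ) (r : κ) :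
    MatEquiv M fun i j => if j = r then - M i j else M i j :=
  (negRow M.transpose r).transpose

end MatEquiv

/-! ### Periodicity of knot diagrams -/

namespace KnotDiagram

theorem curve_add_int (D : KnotDiagram) (t : ℝ) (m : ℤ) : D.curve (t + m) = D.curve t := by
  simpa using D.periodic_curve.int_mul m t

theorem Cross.symm {D : KnotDiagram} {s t : ℝ} (h : D.Cross s t) : D.Cross t s :=
  ⟨h.1.symm, fun m hm => h.2 (-m) (by push_cast; linarith)⟩

theorem Cross.add_int {D : KnotDiagram} {s t : ℝ} (h : D.Cross s t) (m k : ℤ) :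
    D.Cross (s + m) (t + k) :=
  ⟨by rw [D.curve_add_int, D.curve_add_int]; exact h.1,
    fun l hl => h.2 (k + l - m) (by push_cast; linarith)⟩

theorem Cross.add_int_right {D : KnotDiagram} {s t : ℝ} (h : D.Cross s t) (k : ℤ) :
    D.Cross s (t + k) := by
  simpa using h.add_int 0 k

theorem exists_cross {D : KnotDiagram} {t : ℝ} (h : t ∈ D.under) : ∃ s, D.Cross s t :=
  D.under_crossing t h

theorem add_int_mem_under_of_mem {D : KnotDiagram} {t : ℝ} (h : t ∈ D.under) (m : ℤ) :
    t + m ∈ D.under := by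
  obtain ⟨s, hs⟩ := exists_cross h
  by_contra hm
  exact (D.under_iff s t hs).1 ((D.under_iff s (t + m) (hs.add_int_right m)).2 hm) h

theorem add_int_mem_under {D : KnotDiagram} {t : ℝ} (m : ℤ) : t + m ∈ D.under ↔ t ∈ D.under :=
  ⟨fun h => by simpa using add_int_mem_under_of_mem h (-m), fun h => add_int_mem_under_of_mem h m⟩

theorem Cross.eq_add_int {D : KnotDiagram} {s s' t : ℝ} (h : D.Cross s t) (h' : D.Cross s' t) :
    ∃ m : ℤ, s = s' + m :=
  D.no_triple t s s' h.symm h'.symm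

theorem finite_under (D : KnotDiagram) : {t | t ∈ D.under ∧ t ∈ Set.Ico (0 : ℝ) 1}.Finite :=
  D.finite_crossings.subset fun t ht => ⟨ht.2, D.under_crossing t ht.1⟩

end KnotDiagram

/-! ### Cuts of the circle -/

/-- The numbers `c i` represent different points of the circle `ℝ / ℤ`. -/
def DistinctModInt {ι : Type} (c : ι → ℝ) : Prop :=
  ∀ i j, ∀ m : ℤ, c i = c j + m → i = j

/-- The last of the cuts `c i + m` before `s` is a translate of `c j`. -/
def IsLastCut {ι : Type} (c : ι → ℝ) (j : ι) (s : ℝ) : Prop :=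
  ∃ m : ℤ, c j + m < s ∧ ∀ i, ∀ k : ℤ, c i + k < s → c i + k ≤ c j + m

/-- The index of the last of the cuts `c i + m` before `s`. -/
noncomputable def lastCut {ι : Type} [Nonempty ι] (c : ι → ℝ) (s : ℝ) : ι :=
  Classical.epsilon fun j => IsLastCut c j s

section lastCut

variable {ι : Type} {c : ι → ℝ}

/-- The largest translate of `c i` strictly below `s` is the one by `⌈s - c i⌉ - 1`; finiteness of
`ι` gives a largest one among these. -/
theorem isLastCut_lastCut [Nonempty ι] [Finite ι] (c : ι → ℝ) (s : ℝ) : IsLastCut c (lastCut c s) s := by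
  apply Classical.epsilon_spec (p := fun j => IsLastCut c j s)
  obtain ⟨j, hj⟩ := Finite.exists_max fun j => c j + ((⌈s - c j⌉ - 1 : ℤ) : ℝ)
  refine ⟨j, ⌈s - c j⌉ - 1, ?_, fun i k hk => le_trans ?_ (hj i)⟩
  · have := Int.ceil_lt_add_one (s - c j)
    push_cast
    linarith
  · have : k < ⌈s - c i⌉ := Int.lt_ceil.2 (by linarith)
    have : k ≤ ⌈s - c i⌉ - 1 := by omega
    have : (k : ℝ) ≤ ((⌈s - c i⌉ - 1 : ℤ) : ℝ) := by exact_mod_cast this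
    linarith

theorem IsLastCut.unique (hc : DistinctModInt c) {j j' : ι} {s : ℝ} (h : IsLastCut c j s)
    (h' : IsLastCut c j' s) : j = j' := by
  obtain ⟨m, hm, h⟩ := h
  obtain ⟨m', hm', h'⟩ := h'
  exact hc j j' (m' - m) (by push_cast; linarith [h _ _ hm', h' _ _ hm])

variable [Nonempty ι] [Finite ι]

theorem IsLastCut.lastCut_eq (hc : DistinctModInt c) {j : ι} {s : ℝ} (h : IsLastCut c j s) :
    lastCut c s = j :=
  (isLastCut_lastCut c s).unique hc h

theorem lastCut_add_int (hc : DistinctModInt c) (s : ℝ) (m : ℤ) :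
    lastCut c (s + m) = lastCut c s := by
  obtain ⟨k, hk, h⟩ := isLastCut_lastCut c s
  refine IsLastCut.lastCut_eq hc ⟨k + m, by push_cast; linarith, fun i l hl => ?_⟩
  have := h i (l - m) (by push_cast; linarith)
  push_cast at this ⊢
  linarith

/-- Moving along the circle without passing a cut does not change the last cut. -/
theorem lastCut_eq_of_forall_notMem (hc : DistinctModInt c) {s s' : ℝ} (h : s ≤ s')
    (hs : ∀ i, ∀ m : ℤ, c i + m ∉ Set.Ico s s') : lastCut c s' = lastCut c s := by
  obtain ⟨k, hk, hl⟩ := isLastCut_lastCut c s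
  refine IsLastCut.lastCut_eq hc ⟨k, by linarith, fun i m hm => hl i m ?_⟩
  by_contra hi
  exact hs i m ⟨not_lt.1 hi, hm⟩

/-- If no cut lies between the cut `c j + m` and `s`, then it is the last cut before `s`. -/
theorem lastCut_eq_of_forall_notMem_Ioo (hc : DistinctModInt c) {j : ι} {m : ℤ} {s : ℝ}
    (h : c j + m < s) (hs : ∀ i, ∀ k : ℤ, c i + k ∉ Set.Ioo (c j + m) s) : lastCut c s = j := by
  refine IsLastCut.lastCut_eq hc ⟨m, h, fun i k hk => ?_⟩
  by_contra hi
  exact hs i k ⟨not_le.1 hi, hk⟩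

/-- A place whose last cut is the cut `c j`, which is followed by the cut `c i + k`, lies between
these two cuts. -/
theorem exists_mem_Ioc_of_lastCut_eq {j i : ι} {k : ℤ} {s : ℝ} (h : lastCut c s = j)
    (hij : c j < c i + k) : ∃ m : ℤ, s + m ∈ Set.Ioc (c j) (c i + k) := by
  obtain ⟨m, hm, hl⟩ := isLastCut_lastCut c s
  rw [h] at hm hl
  refine ⟨-m, by push_cast; linarith, ?_⟩
  by_contra hs
  have := hl i (k + m) (by push_cast at hs ⊢; linarith)
  push_cast at this
  linarith

/-- The last cut depends only on the order of the cuts on the circle. -/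
theorem lastCut_eq_apply_lastCut {ι' : Type} [Nonempty ι'] [Finite ι'] {c' : ι' → ℝ}
    (hc' : DistinctModInt c') (e : ι ≃ ι') (a : ι → ℤ) {s s' : ℝ}
    (hs : ∀ i, ∀ m : ℤ, c i + m < s ↔ c' (e i) + (m + a i : ℤ) < s')
    (hl : ∀ i j, ∀ m : ℤ, c i + m ≤ c j → c' (e i) + (m + a i : ℤ) ≤ c' (e j) + a j) :
    lastCut c' s' = e (lastCut c s) := by
  obtain ⟨k, hk, h⟩ := isLastCut_lastCut c s
  refine IsLastCut.lastCut_eq hc' ⟨k + a (lastCut c s), (hs _ _).1 hk, fun i l hl' => ?_⟩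
  obtain ⟨i, rfl⟩ := e.surjective i
  have h₁ := h i (l - a i) ((hs _ _).2 (by simpa using hl'))
  have h₂ := hl i (lastCut c s) (l - a i - k) (by push_cast at h₁ ⊢; linarith)
  push_cast at h₂ ⊢
  linarith

/-- The cuts other than the cut `i₀`. -/
def removeCut {ι : Type} (c : ι → ℝ) (i₀ : ι) : {i // i ≠ i₀} → ℝ := fun i => c i

/-- The last cut when the cut `i₀` is removed. -/
theorem lastCut_removeCut (hc : DistinctModInt c) (i₀ : ι) [Nonempty {i // i ≠ i₀}] (s : ℝ)
    [Decidable (lastCut c s = i₀)] :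
    (lastCut (removeCut c i₀) s).1 =
      if lastCut c s = i₀ then (lastCut (removeCut c i₀) (c i₀)).1
      else lastCut c s := by
  have hc' : DistinctModInt (removeCut c i₀) :=
    fun i j m h => Subtype.ext (hc i j m h)
  obtain ⟨m, hm, h⟩ := isLastCut_lastCut c s
  split_ifs with hi
  · rw [hi] at hm h
    obtain ⟨k, hk, hl⟩ := isLastCut_lastCut (removeCut c i₀) (c i₀)
    refine congrArg _ (IsLastCut.lastCut_eq hc' ⟨k + m, by push_cast; linarith, fun i l hil => ?_⟩)
    have h₁ := (h i l hil).lt_of_ne fun h' => i.2 (hc i i₀ (m - l) (by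
      push_cast; linarith))
    have h₂ := hl i (l - m) (by dsimp only [removeCut] at h₁ ⊢; push_cast; linarith)
    push_cast at h₂ ⊢
    linarith
  · have : lastCut (removeCut c i₀) s = ⟨lastCut c s, hi⟩ :=
      IsLastCut.lastCut_eq hc' ⟨m, hm, fun i l hil => h i l hil⟩
    rw [this]

/-- The only candidates lost by the removal are translates of `c i₀` itself, at `c i₀ - 1` or
earlier. As another cut exists, one of its translates comes later than these and before `c i₀`. -/
theorem lastCut_apply_eq_lastCut_removeCut (hc : DistinctModInt c) (i₀ : ι)
    [Nonempty {i // i ≠ i₀}] :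
    lastCut c (c i₀) = (lastCut (removeCut c i₀) (c i₀)).1 := by
  obtain ⟨k, hk, hl⟩ := isLastCut_lastCut (removeCut c i₀) (c i₀)
  refine IsLastCut.lastCut_eq hc ⟨k, hk, fun i l hil => ?_⟩
  by_cases hi : i = i₀
  · subst hi
    have h₁ : l ≤ -1 := by
      have : (l : ℝ) < 0 := by linarith
      have : l < 0 := by exact_mod_cast this
      omega
    have h₂ : (l : ℝ) ≤ -1 := by exact_mod_cast h₁
    by_contra h
    -- If the last remaining cut came before `c i + l` with `l ≤ -1`, its translate by one more turn
    -- would still precede `c i`.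
    have := hl (lastCut (removeCut c i) (c i)) (k + 1) (by
      simp only [removeCut] at h ⊢; push_cast; linarith)
    push_cast at this
    linarith
  · exact hl ⟨i, hi⟩ l hil

end lastCut

/-! ### Cut matrices -/

open Classical in
/-- The Kronecker symbol. -/
noncomputable def kron {ι : Type} (i j : ι) : ℤ := if i = j then 1 else 0

@[simp] theorem kron_self {ι : Type} (i : ι) : kron i i = 1 := by simp [kron]

theorem kron_of_ne {ι : Type} {i j : ι} (h : i ≠ j) : kron i j = 0 := by simp [kron, h]

theorem kron_eq_ite {ι : Type} (i j : ι) [Decidable (i = j)] :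
    kron i j = if i = j then 1 else 0 := by
  unfold kron
  congr

theorem kron_apply {ι ι' : Type} {f : ι → ι'} (hf : Function.Injective f) (i j : ι) :
    kron (f i) (f j) = kron i j := by
  by_cases h : i = j
  · simp [h]
  · rw [kron_of_ne h, kron_of_ne (hf.ne h)]

namespace KnotDiagram

/-- The numbers `c i` represent different points of the circle which comprise all the points where
the diagram passes under a crossing. -/
structure IsCutSystem (D : KnotDiagram) {ι : Type} (c : ι → ℝ) : Prop where
  distinct : DistinctModInt c
  cover : ∀ t ∈ D.under, ∃ i, ∃ m : ℤ, t = c i + m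

open Classical in
/-- The coloring matrix of a diagram whose curve is cut at the points `c i`, the `i`-th arc being the
one that starts at `c i`. A cut which is not at an under-passage contributes the equation that the
colors before and after it are the same. -/
noncomputable def cutMatrix (D : KnotDiagram) {ι : Type} [Nonempty ι] (c : ι → ℝ) :
    Matrix ι ι ℤ := fun i j =>
  -- The inequality in `IsLastCut` is strict, so `lastCut c (c i)` is the arc that ends at `c i`,
  -- while arc `i` starts there. The over-passage is determined only up to an integer, which does
  -- not affect its `lastCut`.
  if c i ∈ D.under then
    kron j i + kron j (lastCut c (c i))
      - 2 * kron j (lastCut c (Classical.epsilon fun s => D.Cross s (c i)))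
  else kron j i - kron j (lastCut c (c i))

theorem IsCutSystem.removeCut {D : KnotDiagram} {ι : Type} {c : ι → ℝ} (hc : D.IsCutSystem c) {i₀ : ι} (h : c i₀ ∉ D.under) :
    D.IsCutSystem (removeCut c i₀) where
  distinct := fun i j m h => Subtype.ext (hc.distinct i j m h)
  cover := fun t ht => by
    obtain ⟨i, m, rfl⟩ := hc.cover t ht
    exact ⟨⟨i, fun hi => h (by rwa [add_int_mem_under, hi] at ht)⟩, m, rfl⟩

section cutMatrix

variable {D : KnotDiagram} {ι : Type} [Nonempty ι] {c : ι → ℝ}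

theorem cutMatrix_of_notMem {i : ι} (h : c i ∉ D.under) (j : ι) :
    D.cutMatrix c i j = kron j i - kron j (lastCut c (c i)) := by
  simp [cutMatrix, h]

theorem cutMatrix_of_cross [Finite ι] (hc : DistinctModInt c) {i : ι} {s : ℝ}
    (h : c i ∈ D.under) (hs : D.Cross s (c i)) (j : ι) :
    D.cutMatrix c i j =
      kron j i + kron j (lastCut c (c i)) - 2 * kron j (lastCut c s) := by
  obtain ⟨m, hm⟩ := hs.eq_add_int (Classical.epsilon_spec (p := fun s => D.Cross s (c i)) ⟨s, hs⟩)
  rw [cutMatrix, if_pos h, hm, lastCut_add_int hc]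

/-- A cut that is not at an under-passage may be removed. -/
theorem matEquiv_cutMatrix_removeCut [Finite ι] (hc : D.IsCutSystem c) {i₀ : ι}
    (h : c i₀ ∉ D.under) [Nonempty {i // i ≠ i₀}] :
    MatEquiv (D.cutMatrix c) (D.cutMatrix (removeCut c i₀)) := by
  classical
  have hc' := hc.removeCut h
  set j₀ := lastCut (removeCut c i₀) (c i₀) with hj₀
  have hrow : ∀ j, D.cutMatrix c i₀ j = kron j i₀ - kron j j₀ := fun j => by
    rw [cutMatrix_of_notMem h, lastCut_apply_eq_lastCut_removeCut hc.distinct]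
  -- Removing the cut merges arc `i₀` into `j₀`, the arc before it. This is the substitution that
  -- the Schur complement at `(i₀, i₀)` performs on the columns.
  have hk : ∀ (s : ℝ) (j : {i // i ≠ i₀}),
      kron j (lastCut (removeCut c i₀) s) =
        kron (j : ι) (lastCut c s) + kron i₀ (lastCut c s) * kron (j : ι) j₀ := fun s j => by
    rw [← kron_apply Subtype.val_injective, lastCut_removeCut hc.distinct]
    split_ifs with hi
    · rw [hi, kron_of_ne j.2]
      simp [hj₀]
    · rw [kron_of_ne (Ne.symm hi)]
      simp
  refine (MatEquiv.schur (D.cutMatrix c) i₀ ?_).congr_right fun r j => ?_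
  · rw [hrow, kron_self, kron_of_ne j₀.2.symm, sub_zero]
  · have hR : removeCut c i₀ r = c r := rfl
    rw [hrow, kron_of_ne j.2]
    by_cases hr : c r ∈ D.under
    · obtain ⟨s, hs⟩ := exists_cross hr
      rw [cutMatrix_of_cross hc.distinct hr hs, cutMatrix_of_cross hc.distinct hr hs,
        cutMatrix_of_cross (c := removeCut c i₀) hc'.distinct hr hs, hk, hk, hR,
        kron_of_ne r.2.symm, kron_apply Subtype.val_injective]
      ring
    · rw [cutMatrix_of_notMem hr, cutMatrix_of_notMem hr,
        cutMatrix_of_notMem (c := removeCut c i₀) hr, hk, hR,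
        kron_of_ne r.2.symm, kron_apply Subtype.val_injective]
      ring

/-- The cut matrix depends only on the set of cuts, up to the enumeration. -/
theorem matEquiv_cutMatrix_of_equiv [Finite ι] {ι' : Type} [Finite ι'] [Nonempty ι'] {c' : ι' → ℝ}
    (hc : DistinctModInt c) (hc' : DistinctModInt c') (e : ι ≃ ι') (a : ι → ℤ)
    (h : ∀ i, c' (e i) = c i + a i) : MatEquiv (D.cutMatrix c) (D.cutMatrix c') := by
  have hl : ∀ s, lastCut c' s = e (lastCut c s) := fun s => by
    refine lastCut_eq_apply_lastCut hc' e (fun i => - a i) (fun i m => ?_) fun i j m hm => ?_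
    · rw [h]; push_cast; ring_nf
    · rw [h, h]; push_cast; linarith
  refine ((MatEquiv.submatrix (D.cutMatrix c') e e).congr_right fun i j => ?_).symm
  rw [Matrix.submatrix_apply]
  have hi := add_int_mem_under (D := D) (t := c i) (a i)
  rw [← h] at hi
  have hi' : lastCut c' (c' (e i)) = e (lastCut c (c i)) := by
    rw [h, lastCut_add_int hc', hl]
  by_cases hr : c i ∈ D.under
  · obtain ⟨s, hs⟩ := exists_cross hr
    rw [cutMatrix_of_cross hc hr hs, cutMatrix_of_cross hc' (hi.2 hr)
      (by rw [h]; exact hs.add_int_right _), hi', hl, kron_apply e.injective,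
      kron_apply e.injective, kron_apply e.injective]
  · rw [cutMatrix_of_notMem hr, cutMatrix_of_notMem (mt hi.1 hr), hi', kron_apply e.injective,
      kron_apply e.injective]

/-- Two cut systems which consist of under-passages only have equivalent cut matrices. -/
theorem matEquiv_cutMatrix_of_forall_mem [Finite ι] {ι' : Type} [Finite ι'] [Nonempty ι']
    {c' : ι' → ℝ} (hc : D.IsCutSystem c) (hc' : D.IsCutSystem c') (h : ∀ i, c i ∈ D.under)
    (h' : ∀ i, c' i ∈ D.under) : MatEquiv (D.cutMatrix c) (D.cutMatrix c') := by
  choose f a hf using fun i => hc'.cover (c i) (h i)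
  have hb : Function.Bijective f := by
    refine ⟨fun i j hij => hc.distinct i j (a i - a j) ?_, fun i' => ?_⟩
    · rw [hf i, hf j, hij]; push_cast; ring
    · obtain ⟨i, m, hi⟩ := hc.cover (c' i') (h' i')
      refine ⟨i, hc'.distinct _ _ (- m - a i) ?_⟩
      have := hf i
      push_cast
      linarith
  refine matEquiv_cutMatrix_of_equiv hc.distinct hc'.distinct (Equiv.ofBijective f hb)
    (fun i => - a i) fun i => ?_
  have := hf i
  push_cast
  simp only [Equiv.ofBijective_apply]
  linarith

/-- Superfluous cuts are removed one by one. The process can only get stuck at a single superfluous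
cut, as at least one arc must remain; then there is no under-passage at all. -/
theorem exists_reduced_cutSystem (n : ℕ) : ∀ {ι : Type} [Finite ι] [Nonempty ι] {c : ι → ℝ},
    Nat.card ι = n → D.IsCutSystem c →
    ∃ (ι' : Type) (_ : Finite ι') (_ : Nonempty ι') (c' : ι' → ℝ), D.IsCutSystem c' ∧
      MatEquiv (D.cutMatrix c) (D.cutMatrix c') ∧
      ((∀ i, c' i ∈ D.under) ∨ (D.under = ∅ ∧ Subsingleton ι')) := by
  induction n with
  | zero =>
    intro ι _ _ c hn _
    exact absurd hn Nat.card_pos.ne'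
  | succ n ih =>
    intro ι _ _ c hn hc
    by_cases h : ∀ i, c i ∈ D.under
    · exact ⟨ι, ‹_›, ‹_›, c, hc, MatEquiv.refl _, Or.inl h⟩
    push Not at h
    obtain ⟨i₀, hi₀⟩ := h
    by_cases hne : Nonempty {i // i ≠ i₀}
    · obtain ⟨ι', h₁, h₂, c', hc', he, h'⟩ := ih (c := removeCut c i₀)
        (by
          have := Finite.card_option (α := {i // i ≠ i₀})
          classical
          rw [Nat.card_congr (Equiv.optionSubtypeNe i₀)] at this
          omega) (hc.removeCut hi₀)
      exact ⟨ι', h₁, h₂, c', hc', (matEquiv_cutMatrix_removeCut hc hi₀).trans he, h'⟩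
    · have hall : ∀ i, i = i₀ := fun i => by
        by_contra hi
        exact hne ⟨⟨i, hi⟩⟩
      refine ⟨ι, ‹_›, ‹_›, c, hc, MatEquiv.refl _, Or.inr ⟨?_, ?_⟩⟩
      · refine Set.eq_empty_of_forall_notMem fun t ht => ?_
        obtain ⟨i, m, rfl⟩ := hc.cover t ht
        rw [add_int_mem_under, hall i] at ht
        exact hi₀ ht
      · exact ⟨fun i j => (hall i).trans (hall j).symm⟩

/-- The single arc precedes and follows the single cut, so its row is `x - x`. This agrees with the
convention for diagrams without crossings. -/
theorem cutMatrix_eq_zero [Subsingleton ι] (h : D.under = ∅) : D.cutMatrix c = 0 := by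
  ext i j
  rw [cutMatrix_of_notMem (by simp [h]), Subsingleton.elim j i,
    Subsingleton.elim (lastCut c (c i)) i]
  simp

/-- All the cut matrices of a diagram are equivalent. -/
theorem matEquiv_cutMatrix [Finite ι] {ι' : Type} [Finite ι'] [Nonempty ι']
    {c' : ι' → ℝ} (hc : D.IsCutSystem c) (hc' : D.IsCutSystem c') :
    MatEquiv (D.cutMatrix c) (D.cutMatrix c') := by
  obtain ⟨κ, _, _, d, hd, he, h⟩ := exists_reduced_cutSystem _ rfl hc
  obtain ⟨κ', _, _, d', hd', he', h'⟩ := exists_reduced_cutSystem _ rfl hc'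
  refine he.trans (MatEquiv.trans ?_ he'.symm)
  rcases h with h | ⟨hU, _⟩ <;> rcases h' with h' | ⟨hU', _⟩
  · exact matEquiv_cutMatrix_of_forall_mem hd hd' h h'
  · have := h (Classical.arbitrary κ)
    simp [hU'] at this
  · have := h' (Classical.arbitrary κ')
    simp [hU] at this
  · have e : κ' ≃ κ := @Equiv.ofUnique _ _
      (uniqueOfSubsingleton (Classical.arbitrary κ')) (uniqueOfSubsingleton (Classical.arbitrary κ))
    rw [cutMatrix_eq_zero hU, cutMatrix_eq_zero hU]
    exact MatEquiv.submatrix 0 e e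

end cutMatrix

end KnotDiagram

/-! ### Coloring matrices are cut matrices -/

theorem int_eq_zero_of_mem_Ico {a b : ℝ} {m : ℤ} (ha : a ∈ Set.Ico (0 : ℝ) 1)
    (hb : b ∈ Set.Ico (0 : ℝ) 1) (h : a = b + m) : m = 0 := by
  have h₁ : (m : ℝ) < 1 := by linarith [ha.2, hb.1]
  have h₂ : (-1 : ℝ) < m := by linarith [ha.1, hb.2]
  have h₁ : m < 1 := by exact_mod_cast h₁
  have h₂ : -1 < m := by exact_mod_cast h₂
  omega

namespace KnotDiagram

section traversal

variable {n : ℕ} {τ : Fin n → ℝ}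

/-- There is no passage under a crossing between the start and the end of an arc. -/
theorem add_int_notMem_Ioo_arcEnd (hmono : StrictMono τ) (hmem : ∀ i, τ i ∈ Set.Ico (0 : ℝ) 1)
    (k i : Fin n) (m : ℤ) : τ i + m ∉ Set.Ioo (τ k) (arcEnd τ k) := by
  obtain _ | n := n
  · exact k.elim0
  rintro ⟨h₁, h₂⟩
  have hi := hmem i
  have hk := hmem k
  by_cases hl : k = Fin.last n
  · subst hl
    have h0 := hmem 0
    have hle : τ 0 ≤ τ i := hmono.monotone (Fin.zero_le i)
    have hle' : τ i ≤ τ (Fin.last n) := hmono.monotone (Fin.le_last i)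
    simp only [arcEnd, finRotate_last, Fin.not_lt_zero, if_false] at h₂
    have hm₁ : (m : ℝ) < 1 := by linarith
    have hm₂ : (0 : ℝ) < m := by linarith
    have hm₁ : m < 1 := by exact_mod_cast hm₁
    have hm₂ : 0 < m := by exact_mod_cast hm₂
    omega
  · have hlt : (k : ℕ) < n := Fin.val_lt_last hl
    have hr : ((finRotate (n + 1) k : Fin (n + 1)) : ℕ) = k + 1 := coe_finRotate_of_ne_last hl
    have hkr : k < finRotate (n + 1) k := Fin.lt_def.2 (by omega)
    have hr' := hmem (finRotate (n + 1) k)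
    rw [arcEnd, if_pos hkr] at h₂
    have hm : m = 0 := int_eq_zero_of_mem_Ico (a := τ i + m) ⟨by linarith [hk.1], by linarith [hr'.2]⟩ hi rfl
    subst hm
    simp only [Int.cast_zero, add_zero] at h₁ h₂
    have := Fin.lt_def.1 (hmono.lt_iff_lt.1 h₁)
    have := Fin.lt_def.1 (hmono.lt_iff_lt.1 h₂)
    omega

theorem lt_arcEnd (hmono : StrictMono τ) (hmem : ∀ i, τ i ∈ Set.Ico (0 : ℝ) 1) (k : Fin n) :
    τ k < arcEnd τ k := by
  unfold arcEnd
  split_ifs with h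
  · exact hmono h
  · linarith [(hmem k).2, (hmem (finRotate n k)).1]

theorem exists_arcEnd_eq (τ : Fin n → ℝ) (k : Fin n) :
    ∃ m : ℤ, arcEnd τ k = τ (finRotate n k) + m := by
  unfold arcEnd
  split_ifs
  · exact ⟨0, by simp⟩
  · exact ⟨1, by simp⟩

variable {D : KnotDiagram} {p ε : ℝ}

theorem IsTraversal.mem_under (h : D.IsTraversal p ε τ) (i : Fin n) : p + ε * τ i ∈ D.under :=
  (h.under_iff _ (h.mem_Ico i)).2 ⟨i, rfl⟩

theorem IsTraversal.isCutSystem (h : D.IsTraversal p ε τ) :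
    D.IsCutSystem fun i => p + ε * τ i where
  distinct := fun i j m hij => by
    apply h.strictMono.injective
    rcases h.direction with rfl | rfl
    · have hij : τ i = τ j + m := by linarith
      have := int_eq_zero_of_mem_Ico (h.mem_Ico i) (h.mem_Ico j) hij
      subst this
      simpa using hij
    · have hij : τ i = τ j + ((-m : ℤ) : ℝ) := by push_cast; linarith
      have := int_eq_zero_of_mem_Ico (h.mem_Ico i) (h.mem_Ico j) hij
      rw [this] at hij
      simpa using hij
  cover := fun t ht => by
    rcases h.direction with rfl | rfl
    · obtain ⟨i, hi⟩ := (h.under_iff (Int.fract (t - p))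
        ⟨Int.fract_nonneg _, Int.fract_lt_one _⟩).1 (by
          have : p + 1 * Int.fract (t - p) = t + ((-⌊t - p⌋ : ℤ) : ℝ) := by
            rw [Int.fract]; push_cast; ring
          rwa [this, add_int_mem_under])
      exact ⟨i, ⌊t - p⌋, by rw [hi, Int.fract]; ring⟩
    · obtain ⟨i, hi⟩ := (h.under_iff (Int.fract (p - t))
        ⟨Int.fract_nonneg _, Int.fract_lt_one _⟩).1 (by
          have : p + -1 * Int.fract (p - t) = t + (⌊p - t⌋ : ℝ) := by
            rw [Int.fract]; ring
          rwa [this, add_int_mem_under])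
      exact ⟨i, -⌊p - t⌋, by rw [hi, Int.fract]; push_cast; ring⟩

variable [Nonempty (Fin n)]

/-- In the positive direction, the last cut before a point up to the end of an arc is the start of
the arc. -/
theorem IsTraversal.lastCut_of_mem_Ioc (h : D.IsTraversal p 1 τ) {k : Fin n} {t : ℝ}
    (ht : t ∈ Set.Ioc (τ k) (arcEnd τ k)) (m : ℤ) :
    lastCut (fun i => p + 1 * τ i) (p + 1 * t + m) = k := by
  refine lastCut_eq_of_forall_notMem_Ioo h.isCutSystem.distinct (m := m) (by linarith [ht.1])
    fun i l hl => ?_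
  refine add_int_notMem_Ioo_arcEnd h.strictMono h.mem_Ico k i (l - m) ⟨?_, ?_⟩
  · push_cast; linarith [hl.1]
  · push_cast; linarith [hl.2, ht.2]

/-- In the negative direction, the last cut before a point of an arc is the end of the arc. -/
theorem IsTraversal.lastCut_of_mem_Ico (h : D.IsTraversal p (-1) τ) {k : Fin n} {t : ℝ}
    (ht : t ∈ Set.Ico (τ k) (arcEnd τ k)) (m : ℤ) :
    lastCut (fun i => p + -1 * τ i) (p + -1 * t + m) = finRotate n k := by
  obtain ⟨r, hr⟩ := exists_arcEnd_eq τ k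
  refine lastCut_eq_of_forall_notMem_Ioo h.isCutSystem.distinct (m := m - r)
    (by push_cast; linarith [ht.2]) fun i l hl => ?_
  push_cast at hl
  refine add_int_notMem_Ioo_arcEnd h.strictMono h.mem_Ico k i (m - l) ⟨?_, ?_⟩
  · push_cast; linarith [hl.2, ht.1]
  · push_cast; linarith [hl.1]

end traversal

/-- Every coloring matrix is, up to the enumeration of rows and columns, a cut matrix. -/
theorem IsColoringMatrix.exists_cutSystem {D : KnotDiagram} {n : ℕ} {M : Matrix (Fin n) (Fin n) ℤ}
    (h : D.IsColoringMatrix M) : ∃ (c : Fin n → ℝ) (_ : Nonempty (Fin n)),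
      D.IsCutSystem c ∧ MatEquiv M (D.cutMatrix c) := by
  rcases h with ⟨hU, rfl, rfl⟩ | ⟨hn, p, ε, τ, ov, hτ, hov, hM⟩
  · refine ⟨0, inferInstance, ⟨fun i j _ _ => Subsingleton.elim i j, by simp [hU]⟩, ?_⟩
    rw [cutMatrix_eq_zero hU]
    exact MatEquiv.refl _
  · have hne : Nonempty (Fin n) := ⟨⟨0, hn⟩⟩
    have hc := hτ.isCutSystem
    refine ⟨_, hne, hc, ?_⟩
    rcases hτ.direction with rfl | rfl
    · refine (MatEquiv.refl M).congr_right fun i j => ?_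
      obtain ⟨s, hs, t, ht, m, rfl⟩ := hov i
      rw [cutMatrix_of_cross hc.distinct (hτ.mem_under i) hs, hM,
        hτ.lastCut_of_mem_Ioc ⟨ht.1, ht.2.le⟩]
      obtain ⟨k, rfl⟩ := (finRotate n).surjective i
      obtain ⟨r, hr⟩ := exists_arcEnd_eq τ k
      have hk : lastCut (fun i => p + 1 * τ i) (p + 1 * τ (finRotate n k)) = k := by
        have := hτ.lastCut_of_mem_Ioc
          ⟨lt_arcEnd hτ.strictMono hτ.mem_Ico k, le_refl (arcEnd τ k)⟩ (-r)
        rw [hr] at this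
        rwa [show p + 1 * (τ (finRotate n k) + r) + ((-r : ℤ) : ℝ) = p + 1 * τ (finRotate n k) by
          push_cast; ring] at this
      simp only [hk, kron_eq_ite, EmbeddingLike.apply_eq_iff_eq]
    -- Against the parametrization, the traversal arc `k` ends where the parametrized arc starts, at
    -- the cut `finRotate n k`; the columns are permuted accordingly and the two under-arcs exchange
    -- their roles.
    · refine (MatEquiv.submatrix M (Equiv.refl _) (finRotate n).symm).congr_right fun i j => ?_
      obtain ⟨s, hs, t, ht, m, rfl⟩ := hov i
      rw [cutMatrix_of_cross hc.distinct (hτ.mem_under i) hs, Matrix.submatrix_apply, hM,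
        hτ.lastCut_of_mem_Ico ⟨ht.1.le, ht.2⟩]
      have hi : lastCut (fun i => p + -1 * τ i) (p + -1 * τ i) = finRotate n i := by
        simpa using hτ.lastCut_of_mem_Ico
          ⟨le_refl (τ i), lt_arcEnd hτ.strictMono hτ.mem_Ico i⟩ 0
      simp only [hi, kron_eq_ite, Equiv.coe_refl, id, Equiv.apply_symm_apply, Equiv.symm_apply_eq]
      ring

/-- A coloring matrix is equivalent to all the cut matrices of the diagram. -/
theorem IsColoringMatrix.matEquiv_cutMatrix {D : KnotDiagram} {n : ℕ}
    {M : Matrix (Fin n) (Fin n) ℤ} (h : D.IsColoringMatrix M) {ι : Type} [Finite ι] [Nonempty ι]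
    {c : ι → ℝ} (hc : D.IsCutSystem c) : MatEquiv M (D.cutMatrix c) := by
  obtain ⟨d, _, hd, he⟩ := h.exists_cutSystem
  exact he.trans (KnotDiagram.matEquiv_cutMatrix hd hc)

end KnotDiagram

/-! ### Cuts in disjoint strands -/

/-- The points of `O` represent different points of the circle outside of the disjoint strands
`[a i, b i]`, and the `z r` are different points of the strands, `z r` lying on the
strand `σ r`. -/
structure StrandCuts {k : ℕ} (a b : Fin k → ℝ) (O : Set ℝ) {κ : Type} (σ : κ → Fin k)
    (z : κ → ℝ) : Prop where
  disjoint : ∀ i j, ∀ s ∈ Set.Icc (a i) (b i), ∀ t ∈ Set.Icc (a j) (b j), ∀ m : ℤ,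
    s = t + m → i = j ∧ s = t
  mem_Ico : ∀ t ∈ O, t ∈ Set.Ico (0 : ℝ) 1
  notMem : ∀ t ∈ O, ∀ i, ∀ m : ℤ, t + m ∉ Set.Icc (a i) (b i)
  mem : ∀ r, z r ∈ Set.Icc (a (σ r)) (b (σ r))
  inj : Function.Injective z

/-- The family of cuts that consists of the points of `O` and the points `z r`. -/
def joinCuts (O : Set ℝ) {κ : Type} (z : κ → ℝ) : O ⊕ κ → ℝ := Sum.elim Subtype.val z

theorem joinCuts_inl (O : Set ℝ) {κ : Type} (z : κ → ℝ) (t : O) :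
    joinCuts O z (Sum.inl t) = t := rfl

theorem joinCuts_inr (O : Set ℝ) {κ : Type} (z : κ → ℝ) (r : κ) :
    joinCuts O z (Sum.inr r) = z r := rfl

namespace StrandCuts

variable {k : ℕ} {a b : Fin k → ℝ} {O : Set ℝ} {κ : Type} {σ : κ → Fin k} {z z' : κ → ℝ}

theorem distinctModInt (h : StrandCuts a b O σ z) : DistinctModInt (joinCuts O z) := by
  rintro (i | r) (j | r') m hm <;> simp only [joinCuts, Sum.elim_inl, Sum.elim_inr] at hm
  · have := int_eq_zero_of_mem_Ico (h.mem_Ico _ i.2) (h.mem_Ico _ j.2) hm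
    subst this
    exact congrArg _ (Subtype.ext (by simpa using hm))
  · refine absurd (h.mem r') ?_
    rw [show z r' = i + ((-m : ℤ) : ℝ) by push_cast; linarith]
    exact h.notMem _ i.2 _ _
  · refine absurd (h.mem r) ?_
    rw [hm]
    exact h.notMem _ j.2 _ _
  · exact congrArg _ (h.inj (h.disjoint _ _ _ (h.mem r) _ (h.mem r') m hm).2)

theorem eq_inr_of_mem (h : StrandCuts a b O σ z) {x : O ⊕ κ} {m : ℤ} {l : Fin k}
    (hx : joinCuts O z x + m ∈ Set.Icc (a l) (b l)) : ∃ r, x = Sum.inr r ∧ σ r = l ∧ m = 0 := by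
  rcases x with t | r
  · exact absurd hx (h.notMem _ t.2 l m)
  · obtain ⟨h₁, h₂⟩ := h.disjoint _ _ _ hx _ (h.mem r) m rfl
    exact ⟨r, rfl, h₁.symm, by simpa [joinCuts] using h₂⟩

/-- Two different translates of strands are disjoint intervals, so one lies entirely before the
other; otherwise the larger of their left endpoints would belong to both. -/
theorem add_lt_of_add_le (h : StrandCuts a b O σ z) {i j : Fin k} {m : ℤ} (hij : ¬(i = j ∧ m = 0))
    {s s' t t' : ℝ} (hs : s ∈ Set.Icc (a i) (b i)) (hs' : s' ∈ Set.Icc (a i) (b i))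
    (ht : t ∈ Set.Icc (a j) (b j)) (ht' : t' ∈ Set.Icc (a j) (b j)) (hst : s + m ≤ t) :
    s' + m < t' := by
  by_contra hc
  have hc := not_lt.1 hc
  obtain ⟨u, hu⟩ : ∃ u, u = max (a i + m) (a j) := ⟨_, rfl⟩
  have h₁ : a i + m ≤ u := hu ▸ le_max_left _ _
  have h₂ : a j ≤ u := hu ▸ le_max_right _ _
  have h₃ : u ≤ b i + m := hu ▸ max_le (by linarith [hs.1, hs.2]) (by linarith [ht'.1, hs'.2])
  have h₄ : u ≤ b j := hu ▸ max_le (by linarith [hs.1, ht.2]) (by linarith [ht.1, ht.2])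
  obtain ⟨h₅, h₆⟩ := h.disjoint j i u ⟨h₂, h₄⟩ (u - m) ⟨by linarith, by linarith⟩ m (by ring)
  refine hij ⟨h₅.symm, ?_⟩
  have : (m : ℝ) = 0 := by linarith
  exact_mod_cast this

/-- The points of `O` and the other strands lie wholly on one side of a given strand, so moving a
cut within its strand can only alter its order relative to cuts of the same strand. -/
theorem joinCuts_add_le (h : StrandCuts a b O σ z) (h' : StrandCuts a b O σ z')
    (ho : ∀ r r', σ r = σ r' → z r ≤ z r' → z' r ≤ z' r') (x y : O ⊕ κ) (m : ℤ)
    (hxy : joinCuts O z x + m ≤ joinCuts O z y) : joinCuts O z' x + m ≤ joinCuts O z' y := by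
  rcases x with t | r <;> rcases y with u | r' <;>
    simp only [joinCuts, Sum.elim_inl, Sum.elim_inr] at hxy ⊢
  · exact hxy
  · by_contra hc
    exact h.notMem t t.2 (σ r') m
      ⟨by linarith [(h'.mem r').1], by linarith [(h.mem r').2]⟩
  · by_contra hc
    refine h.notMem u u.2 (σ r) (-m) ⟨?_, ?_⟩
    · push_cast; linarith [(h.mem r).1]
    · push_cast; linarith [(h'.mem r).2]
  · by_cases hr : σ r = σ r' ∧ m = 0
    · obtain ⟨hr, rfl⟩ := hr
      simpa using ho r r' hr (by simpa using hxy)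
    · exact (h.add_lt_of_add_le hr (h.mem r) (h'.mem r) (h.mem r') (h'.mem r') hxy).le

variable [Finite O] [Finite κ] [Nonempty κ]

/-- In a strand, the last cut is the last one of the points `z r` before. -/
theorem lastCut_eq_inr (h : StrandCuts a b O σ z) {r : κ} {s : ℝ} (hr : z r < s)
    (hs : s ≤ b (σ r)) (hn : ∀ r', σ r' = σ r → z r' ∉ Set.Ioo (z r) s) :
    lastCut (joinCuts O z) s = Sum.inr r := by
  refine lastCut_eq_of_forall_notMem_Ioo h.distinctModInt (m := 0)
    (by simpa [joinCuts] using hr) fun x m hx => ?_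
  simp only [joinCuts, Sum.elim_inr, Int.cast_zero, add_zero] at hx
  obtain ⟨r', rfl, hr', rfl⟩ := h.eq_inr_of_mem (x := x) (m := m) (l := σ r)
    ⟨(h.mem r).1.trans hx.1.le, hx.2.le.trans hs⟩
  exact hn r' hr' (by simpa using hx)

/-- The last cut does not change on an interval of a strand without points `z r`. -/
theorem lastCut_eq_lastCut (h : StrandCuts a b O σ z) {l : Fin k} {s s' : ℝ}
    (hs : s ∈ Set.Icc (a l) (b l)) (hs' : s' ∈ Set.Icc (a l) (b l)) (hle : s ≤ s')
    (hn : ∀ r, σ r = l → z r ∉ Set.Ico s s') :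
    lastCut (joinCuts O z) s' = lastCut (joinCuts O z) s := by
  refine lastCut_eq_of_forall_notMem h.distinctModInt hle fun x m hx => ?_
  obtain ⟨r, rfl, hr, rfl⟩ := h.eq_inr_of_mem (x := x) (m := m) (l := l)
    ⟨hs.1.trans hx.1, hx.2.le.trans hs'.2⟩
  exact hn r hr (by simpa [joinCuts] using hx)

/-- If the cut `z r` is followed by the cut `z r'` on the same strand, then only the points in
between have the last cut `z r`. -/
theorem exists_add_int_mem_Ioc (h : StrandCuts a b O σ z) {r r' : κ} (hrr : σ r = σ r')
    (hz : z r < z r') {s : ℝ} (hs : lastCut (joinCuts O z) s = Sum.inr r) :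
    ∃ m : ℤ, s + m ∈ Set.Ioc (z r) (z r') ∧ s + m ∈ Set.Icc (a (σ r)) (b (σ r)) := by
  obtain ⟨m, hm⟩ := exists_mem_Ioc_of_lastCut_eq (c := joinCuts O z) (i := Sum.inr r') (k := 0) hs
    (by simpa [joinCuts] using hz)
  simp only [joinCuts, Sum.elim_inr, Int.cast_zero, add_zero] at hm
  exact ⟨m, hm, (h.mem r).1.trans hm.1.le, hm.2.trans (hrr ▸ (h.mem r').2)⟩

/-- Moving the cuts in the strands without changing their order does not change the last cuts. -/
theorem lastCut_congr (h : StrandCuts a b O σ z) (h' : StrandCuts a b O σ z')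
    (ho : ∀ r r', σ r = σ r' → z r ≤ z r' → z' r ≤ z' r') {s s' : ℝ}
    (hs : ∀ x, ∀ m : ℤ, joinCuts O z x + m < s ↔ joinCuts O z' x + m < s') :
    lastCut (joinCuts O z') s' = lastCut (joinCuts O z) s := by
  refine lastCut_eq_apply_lastCut h'.distinctModInt (Equiv.refl _) (fun _ => 0) (fun x m => ?_)
    fun x y m hxy => ?_
  · simpa using hs x m
  · simpa using h.joinCuts_add_le h' ho x y m hxy

theorem lastCut_congr_of_notMem (h : StrandCuts a b O σ z) (h' : StrandCuts a b O σ z')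
    (ho : ∀ r r', σ r = σ r' → z r ≤ z r' → z' r ≤ z' r') {s : ℝ}
    (hs : ∀ i, ∀ m : ℤ, s + m ∉ Set.Icc (a i) (b i)) :
    lastCut (joinCuts O z') s = lastCut (joinCuts O z) s := by
  refine h.lastCut_congr h' ho fun x m => ?_
  rcases x with t | r <;> simp only [joinCuts, Sum.elim_inl, Sum.elim_inr]
  have hr := h.mem r
  have hr' := h'.mem r
  have := hs (σ r) (-m)
  rw [Set.mem_Icc, not_and_or, not_le, not_le] at this
  push_cast at this
  constructor <;> intro <;> rcases this with this | this <;> linarith [hr.1, hr.2, hr'.1, hr'.2]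

/-- Compares a point of a strand in one diagram with a point of the same strand in the other: only
the cuts on this strand can tell them apart. -/
theorem lastCut_congr_of_mem (h : StrandCuts a b O σ z) (h' : StrandCuts a b O σ z')
    (ho : ∀ r r', σ r = σ r' → z r ≤ z r' → z' r ≤ z' r') {l : Fin k} {s s' : ℝ}
    (hs : s ∈ Set.Icc (a l) (b l)) (hs' : s' ∈ Set.Icc (a l) (b l))
    (hl : ∀ r, σ r = l → (z r < s ↔ z' r < s')) :
    lastCut (joinCuts O z') s' = lastCut (joinCuts O z) s := by
  refine h.lastCut_congr h' ho fun x m => ?_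
  rcases x with t | r <;> simp only [joinCuts, Sum.elim_inl, Sum.elim_inr]
  · have := h.notMem t t.2 l m
    rw [Set.mem_Icc, not_and_or, not_le, not_le] at this
    constructor <;> intro <;> rcases this with this | this <;>
      linarith [hs.1, hs.2, hs'.1, hs'.2]
  · by_cases hr : σ r = l ∧ m = 0
    · obtain ⟨hr, rfl⟩ := hr
      simpa using hl r hr
    · exact ⟨fun hx => h.add_lt_of_add_le hr (h.mem r) (h'.mem r) hs hs' hx.le,
        fun hx => h.add_lt_of_add_le hr (h'.mem r) (h.mem r) hs' hs hx.le⟩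

end StrandCuts

namespace KnotDiagram

/-! ### Local changes -/

section LocalChange

variable {D D' : KnotDiagram} {B : Set Plane} {k : ℕ} {a b : Fin k → ℝ}

/-- The times in `[0, 1)` at which the diagram passes under a crossing outside of `B`. -/
def outerUnder (D : KnotDiagram) (B : Set Plane) : Set ℝ :=
  {t | t ∈ D.under ∧ t ∈ Set.Ico (0 : ℝ) 1 ∧ D.curve t ∉ B}

instance (D : KnotDiagram) (B : Set Plane) : Finite (D.outerUnder B) :=
  (D.finite_under.subset fun _ ht => ⟨ht.1, ht.2.1⟩).to_subtype

theorem MeetsInStrands.curve_mem (h : D.MeetsInStrands B a b) {i : Fin k} {t : ℝ}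
    (ht : t ∈ Set.Icc (a i) (b i)) : D.curve t ∈ B :=
  (h.mem_iff t).2 ⟨i, 0, by simpa using ht⟩

/-- A branch which crosses a strand belongs to a strand, too. -/
theorem MeetsInStrands.exists_cross (h : D.MeetsInStrands B a b) {i : Fin k} {t : ℝ}
    (ht : t ∈ Set.Icc (a i) (b i)) (hU : t ∈ D.under) :
    ∃ j, ∃ s ∈ Set.Icc (a j) (b j), D.Cross s t := by
  obtain ⟨s, hs⟩ := KnotDiagram.exists_cross hU
  have hB := h.curve_mem ht
  rw [← hs.1] at hB
  obtain ⟨j, m, hm⟩ := (h.mem_iff s).1 hB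
  exact ⟨j, s + m, hm, by simpa using hs.add_int m 0⟩

theorem MeetsInStrands.strandCuts (h : D.MeetsInStrands B a b) {κ : Type} {σ : κ → Fin k}
    {z : κ → ℝ} (hz : ∀ r, z r ∈ Set.Icc (a (σ r)) (b (σ r))) (hi : Function.Injective z) :
    StrandCuts a b (D.outerUnder B) σ z where
  disjoint := h.disjoint
  mem_Ico := fun _ ht => ht.2.1
  notMem := fun t ht i m hm => ht.2.2 ((h.mem_iff t).2 ⟨i, m, hm⟩)
  mem := hz
  inj := hi

theorem MeetsInStrands.isCutSystem (h : D.MeetsInStrands B a b) {κ : Type} {σ : κ → Fin k}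
    {z : κ → ℝ} (hz : StrandCuts a b (D.outerUnder B) σ z)
    (hU : ∀ i, ∀ t ∈ Set.Icc (a i) (b i), t ∈ D.under → ∃ r, t = z r) :
    D.IsCutSystem (joinCuts (D.outerUnder B) z) where
  distinct := hz.distinctModInt
  cover := fun t ht => by
    by_cases hB : D.curve t ∈ B
    · obtain ⟨i, m, hm⟩ := (h.mem_iff t).1 hB
      obtain ⟨r, hr⟩ := hU i _ hm (add_int_mem_under_of_mem ht m)
      exact ⟨Sum.inr r, -m, by simp [joinCuts, ← hr]⟩
    · have hf : Int.fract t = t + ((-⌊t⌋ : ℤ) : ℝ) := by rw [Int.fract]; push_cast; ring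
      refine ⟨Sum.inl ⟨Int.fract t, ?_, ⟨Int.fract_nonneg t, Int.fract_lt_one t⟩, ?_⟩, ⌊t⌋, ?_⟩
      · rwa [hf, add_int_mem_under]
      · rwa [hf, curve_add_int]
      · simp [joinCuts]

/-- The right-hand side involves only the intervals, so both diagrams of a local change are inside
the disc at the same parameters; this makes `LocalChange` symmetric. -/
theorem MeetsInStrands.mem_interior_iff (h : D.MeetsInStrands B a b) (t : ℝ) :
    D.curve t ∈ interior B ↔ ∃ i, ∃ m : ℤ, t + m ∈ Set.Ioo (a i) (b i) := by
  constructor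
  · intro ht
    obtain ⟨i, m, hm⟩ := (h.mem_iff t).1 (interior_subset ht)
    rw [← D.curve_add_int t m] at ht
    refine ⟨i, m, hm.1.lt_of_ne fun he => ?_, hm.2.lt_of_ne fun he => ?_⟩
    · exact (he ▸ h.left_mem_frontier i).2 ht
    · exact (he.symm ▸ h.right_mem_frontier i).2 ht
  · rintro ⟨i, m, hm⟩
    rw [← D.curve_add_int t m]
    exact h.mem_interior i _ hm

theorem LocalChange.symm (h : LocalChange D D' B a b) : LocalChange D' D B a b where
  isDisc := h.isDisc
  strands := h.strands'
  strands' := h.strands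
  curve_eq := fun t ht => (h.curve_eq t (by
    rwa [h.strands.mem_interior_iff, ← h.strands'.mem_interior_iff])).symm
  under_iff := fun t ht => (h.under_iff t (by
    rwa [h.strands.mem_interior_iff, ← h.strands'.mem_interior_iff])).symm

theorem LocalChange.outerUnder_subset (h : LocalChange D D' B a b) :
    D.outerUnder B ⊆ D'.outerUnder B := fun t ht => by
  have hi : D.curve t ∉ interior B := fun hi => ht.2.2 (interior_subset hi)
  exact ⟨(h.under_iff t hi).2 ht.1, ht.2.1, by rw [h.curve_eq t hi]; exact ht.2.2⟩

theorem LocalChange.outerUnder_eq (h : LocalChange D D' B a b) :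
    D'.outerUnder B = D.outerUnder B :=
  h.symm.outerUnder_subset.antisymm h.outerUnder_subset

theorem LocalChange.isCutSystem (h : LocalChange D D' B a b) {κ : Type} {σ : κ → Fin k}
    {z : κ → ℝ} (hz : StrandCuts a b (D.outerUnder B) σ z)
    (hU : ∀ i, ∀ t ∈ Set.Icc (a i) (b i), t ∈ D'.under → ∃ r, t = z r) :
    D'.IsCutSystem (joinCuts (D.outerUnder B) z) := by
  rw [← h.outerUnder_eq] at hz ⊢
  exact h.strands'.isCutSystem hz hU

theorem LocalChange.exists_cross (h : LocalChange D D' B a b) {t : ℝ} (ht : t ∈ D.outerUnder B) :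
    ∃ s : ℝ, (∀ i, ∀ m : ℤ, s + m ∉ Set.Icc (a i) (b i)) ∧ D.Cross s t ∧ D'.Cross s t := by
  obtain ⟨s, hs⟩ := KnotDiagram.exists_cross ht.1
  have hsB : D.curve s ∉ B := by rw [hs.1]; exact ht.2.2
  refine ⟨s, fun i m hm => hsB ((h.strands.mem_iff s).2 ⟨i, m, hm⟩), hs, ?_, hs.2⟩
  rw [h.curve_eq s fun hi => hsB (interior_subset hi),
    h.curve_eq t fun hi => ht.2.2 (interior_subset hi)]
  exact hs.1

/-- The rows of the crossings outside of the disc are not changed. -/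
theorem LocalChange.cutMatrix_inl (h : LocalChange D D' B a b) {κ : Type} [Finite κ] [Nonempty κ]
    {σ : κ → Fin k} {z z' : κ → ℝ} (hz : StrandCuts a b (D.outerUnder B) σ z)
    (hz' : StrandCuts a b (D.outerUnder B) σ z')
    (ho : ∀ r r', σ r = σ r' → z r ≤ z r' → z' r ≤ z' r') (t : D.outerUnder B)
    (j : D.outerUnder B ⊕ κ) :
    D'.cutMatrix (joinCuts (D.outerUnder B) z') (Sum.inl t) j =
      D.cutMatrix (joinCuts (D.outerUnder B) z) (Sum.inl t) j := by
  obtain ⟨s, hs, hst, hst'⟩ := h.exists_cross t.2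
  rw [cutMatrix_of_cross hz.distinctModInt (i := Sum.inl t) t.2.1 hst,
    cutMatrix_of_cross hz'.distinctModInt (i := Sum.inl t) (h.outerUnder_subset t.2).1 hst',
    hz.lastCut_congr_of_notMem hz' ho hs]
  rw [joinCuts_inl, joinCuts_inl, hz.lastCut_congr_of_notMem hz' ho (hz.notMem t t.2)]

/-- An arc which lies in the disc does not occur in the rows of the crossings outside. -/
theorem LocalChange.cutMatrix_inl_inr (h : LocalChange D D' B a b) {κ : Type} [Finite κ]
    [Nonempty κ] {σ : κ → Fin k} {z : κ → ℝ} (hz : StrandCuts a b (D.outerUnder B) σ z)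
    {r r' : κ} (hrr : σ r = σ r') (hlt : z r < z r') (t : D.outerUnder B) :
    D.cutMatrix (joinCuts (D.outerUnder B) z) (Sum.inl t) (Sum.inr r) = 0 := by
  obtain ⟨s, hs, hst, -⟩ := h.exists_cross t.2
  have key : ∀ s : ℝ, (∀ i, ∀ m : ℤ, s + m ∉ Set.Icc (a i) (b i)) →
      Sum.inr r ≠ lastCut (joinCuts (D.outerUnder B) z) s := fun s hs hl => by
    obtain ⟨m, -, hm⟩ := hz.exists_add_int_mem_Ioc hrr hlt hl.symm
    exact hs _ m hm
  rw [cutMatrix_of_cross hz.distinctModInt (i := Sum.inl t) t.2.1 hst, kron_of_ne Sum.inr_ne_inl,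
    kron_of_ne (key s hs), joinCuts_inl, kron_of_ne (key _ (hz.notMem t t.2))]
  simp

end LocalChange

end KnotDiagram

/-! ### The matrix transformations of the moves -/

/-- Here `x`, `e₁`, `e₂` are the successive arcs of the lower strand and `z` is the over-arc.
Substituting `2z - e₁` for `e₁` turns the rows of `N'` into those of `N`, the first one with the
opposite sign. -/
theorem MatEquiv.of_typeII {ι : Type} [Finite ι] {N N' : Matrix ι ι ℤ} {e₁ e₂ x z : ι}
    (h₂ : e₂ ≠ e₁) (hx : x ≠ e₁) (hz : z ≠ e₁)
    (hN₁ : ∀ j, N e₁ j = kron j e₁ - kron j x) (hN₂ : ∀ j, N e₂ j = kron j e₂ - kron j e₁)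
    (hN₁' : ∀ j, N' e₁ j = kron j e₁ + kron j x - 2 * kron j z)
    (hN₂' : ∀ j, N' e₂ j = kron j e₂ + kron j e₁ - 2 * kron j z)
    (hN : ∀ i, i ≠ e₁ → i ≠ e₂ → N i e₁ = 0) (hNN : ∀ i, i ≠ e₁ → i ≠ e₂ → N' i = N i) :
    MatEquiv N N' := by
  classical
  refine MatEquiv.symm ((MatEquiv.addCols N' e₁ (fun j => 2 * kron j z)
    (by simp [kron_of_ne hz.symm])).trans
      ((MatEquiv.negCol _ e₁).trans ((MatEquiv.negRow _ e₁).congr_right fun i j => ?_)))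
  by_cases hi₁ : i = e₁
  · subst hi₁
    by_cases hj : j = i
    · subst hj
      simp [hN₁, hN₁', kron_of_ne hx.symm, kron_of_ne hz.symm]
    · simp [hj, hN₁, hN₁', kron_of_ne hx.symm, kron_of_ne hz.symm, kron_of_ne hj]
  by_cases hi₂ : i = e₂
  · subst hi₂
    by_cases hj : j = e₁
    · subst hj
      simp [hi₁, hN₂, hN₂', kron_of_ne h₂.symm, kron_of_ne hz.symm]
    · simp [hi₁, hj, hN₂, hN₂', kron_of_ne h₂.symm, kron_of_ne hz.symm, kron_of_ne hj]
  · by_cases hj : j = e₁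
    · subst hj
      simp [hi₁, hNN i hi₁ hi₂, hN i hi₁ hi₂]
    · simp [hi₁, hj, hNN i hi₁ hi₂, hN i hi₁ hi₂]

/-- The middle strand passes from `p₁` to `α` under the top arc `z`; the bottom strand runs through
`p₂`, `β`, `γ`, under `z` and then `w` in `N`, under `w'` and then `z` in `N'`. Substituting `β + 2z
- 2w'` for `β` corrects row `β`. Row `γ` is then off by `4z - 2w - 2w'`, which by `hww` is `-2`
times row `α`. -/
theorem MatEquiv.of_typeIII {ι : Type} [Finite ι] {N N' : Matrix ι ι ℤ} {α β γ p₁ p₂ z w w' : ι}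
    (hαβ : α ≠ β) (hαγ : α ≠ γ) (hβγ : β ≠ γ) (hp₁ : p₁ ≠ β) (hp₂ : p₂ ≠ β) (hz : z ≠ β)
    (hw : w ≠ β) (hw' : w' ≠ β) (hww : ∀ j, kron j w + kron j w' = kron j α + kron j p₁)
    (hNα : ∀ j, N α j = kron j α + kron j p₁ - 2 * kron j z)
    (hNβ : ∀ j, N β j = kron j β + kron j p₂ - 2 * kron j z)
    (hNγ : ∀ j, N γ j = kron j γ + kron j β - 2 * kron j w)
    (hNα' : ∀ j, N' α j = kron j α + kron j p₁ - 2 * kron j z)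
    (hNβ' : ∀ j, N' β j = kron j β + kron j p₂ - 2 * kron j w')
    (hNγ' : ∀ j, N' γ j = kron j γ + kron j β - 2 * kron j z)
    (hN : ∀ i, i ≠ α → i ≠ β → i ≠ γ → N i β = 0)
    (hNN : ∀ i, i ≠ α → i ≠ β → i ≠ γ → N' i = N i) :
    MatEquiv N N' := by
  refine (MatEquiv.addCols N β (fun j => 2 * kron j z - 2 * kron j w')
    (by simp [kron_of_ne hz.symm, kron_of_ne hw'.symm])).trans
      ((MatEquiv.addRows _ α (fun i => 2 * kron i γ)
        (by simp [kron_of_ne hαγ])).congr_right fun i j => ?_)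
  have hα0 : N α β = 0 := by
    simp [hNα, kron_of_ne hαβ.symm, kron_of_ne hp₁.symm, kron_of_ne hz.symm]
  have hβ0 : N β β = 1 := by simp [hNβ, kron_of_ne hp₂.symm, kron_of_ne hz.symm]
  have hγ0 : N γ β = 1 := by simp [hNγ, kron_of_ne hβγ, kron_of_ne hw.symm]
  simp only [hα0]
  by_cases hiα : i = α
  · subst hiα
    rw [hα0, kron_of_ne hαγ, hNα, hNα']
    ring
  by_cases hiβ : i = β
  · subst hiβ
    rw [hβ0, kron_of_ne hβγ, hNβ, hNβ']
    ring
  by_cases hiγ : i = γ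
  · subst hiγ
    rw [hγ0, kron_self, hNγ, hNγ', hNα]
    linear_combination -2 * hww j
  · rw [hN i hiα hiβ hiγ, kron_of_ne hiγ, hNN i hiα hiβ hiγ]
    ring

namespace KnotDiagram

/-! ### Invariance under the moves -/

/-- The two diagrams have equivalent cut matrices. -/
def EquivCutMatrices (D D' : KnotDiagram) : Prop :=
  ∃ (ι : Type) (_ : Finite ι) (_ : Nonempty ι) (c c' : ι → ℝ),
    D.IsCutSystem c ∧ D'.IsCutSystem c' ∧ MatEquiv (D.cutMatrix c) (D'.cutMatrix c')

theorem EquivCutMatrices.symm {D D' : KnotDiagram} (h : EquivCutMatrices D D') :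
    EquivCutMatrices D' D := by
  obtain ⟨ι, h₁, h₂, c, c', hc, hc', h⟩ := h
  exact ⟨ι, h₁, h₂, c', c, hc', hc, h.symm⟩

/-- Both diagrams are cut at the under-passage `q` of the kink, which is a superfluous cut of `D`.
With `y` the arc before `q` and `x` the arc after it, `D` has the row `x - y`. In `D'` the over-arc
is `x` if `q < o` and `y` if `o < q`, so the row `x + y - 2z` becomes `y - x` or `x - y`. -/
theorem ReidemeisterI.equivCutMatrices {D D' : KnotDiagram} (h : ReidemeisterI D D') :
    EquivCutMatrices D D' := by
  obtain ⟨B, a, b, hL, hD, ⟨⟨q₁, q₂⟩, ⟨hq₁, hq₂, hlt, hq⟩, huniq⟩⟩ := h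
  obtain ⟨q, o, hqI, hoI, hU, hcr, hqo⟩ : ∃ q o, q ∈ Set.Icc (a 0) (b 0) ∧
      o ∈ Set.Icc (a 0) (b 0) ∧ q ∈ D'.under ∧ D'.Cross o q ∧ ∀ s ∈ Set.Icc (a 0) (b 0),
        ∀ t ∈ Set.Icc (a 0) (b 0), D'.Cross s t → t ∈ D'.under → t = q := by
    have key : ∀ s ∈ Set.Icc (a 0) (b 0), ∀ t ∈ Set.Icc (a 0) (b 0), D'.Cross s t →
        (s = q₁ ∧ t = q₂) ∨ (s = q₂ ∧ t = q₁) := fun s hs t ht hst => by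
      rcases lt_trichotomy s t with h | h | h
      · exact Or.inl (Prod.ext_iff.1 (huniq (s, t) ⟨hs, ht, h, hst⟩))
      · exact absurd (by simpa using h) (hst.2 0)
      · exact Or.inr (Prod.ext_iff.1 (huniq (t, s) ⟨ht, hs, h, hst.symm⟩)).symm
    have hiff := D'.under_iff q₁ q₂ hq
    by_cases hU : q₁ ∈ D'.under
    · refine ⟨q₁, q₂, hq₁, hq₂, hU, hq.symm, fun s hs t ht hst htU => ?_⟩
      rcases key s hs t ht hst with h | h
      · exact absurd (h.2 ▸ htU) (hiff.1 hU)
      · exact h.2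
    · refine ⟨q₂, q₁, hq₂, hq₁, by_contra fun h => hU (hiff.2 h), hq, fun s hs t ht hst htU => ?_⟩
      rcases key s hs t ht hst with h | h
      · exact h.2
      · exact absurd (h.2 ▸ htU) hU
  have hz : StrandCuts a b (D.outerUnder B) (fun _ : Unit => 0) (fun _ => q) :=
    hL.strands.strandCuts (fun _ => hqI) fun _ _ _ => rfl
  have hnot : ∀ t ∈ Set.Icc (a 0) (b 0), t ∉ D.under := fun t ht htU => by
    obtain ⟨j, s, hs, hst⟩ := hL.strands.exists_cross ht htU
    rw [Subsingleton.elim j 0] at hs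
    exact hD s hs t ht hst
  refine ⟨_, inferInstance, inferInstance, joinCuts (D.outerUnder B) fun _ : Unit => q,
    joinCuts (D.outerUnder B) fun _ : Unit => q,
    hL.strands.isCutSystem hz fun i t ht htU => absurd htU ?_,
    hL.isCutSystem hz fun i t ht htU => ⟨(), ?_⟩, ?_⟩
  · rw [Subsingleton.elim i 0] at ht
    exact hnot t ht
  · obtain ⟨j, s, hs, hst⟩ := hL.strands'.exists_cross ht htU
    rw [Subsingleton.elim j 0] at hs
    rw [Subsingleton.elim i 0] at ht
    exact hqo s hs t ht hst htU
  · classical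
    have hrow := cutMatrix_of_notMem (D := D) (c := joinCuts (D.outerUnder B) fun _ : Unit => q)
      (i := Sum.inr ()) (hnot q hqI)
    have hrow' := cutMatrix_of_cross (D := D') (c := joinCuts (D.outerUnder B) fun _ : Unit => q)
      hz.distinctModInt (i := Sum.inr ()) hU hcr
    have hq' : joinCuts (D.outerUnder B) (fun _ : Unit => q) (Sum.inr ()) = q := rfl
    rw [hq'] at hrow hrow'
    rcases lt_trichotomy q o with h | h | h
    · have ho : lastCut (joinCuts (D.outerUnder B) fun _ : Unit => q) o = Sum.inr () :=
        hz.lastCut_eq_inr (r := ()) h hoI.2 fun r _ hr => lt_irrefl _ hr.1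
      refine (MatEquiv.negRow _ (Sum.inr ())).congr_right fun i j => ?_
      rcases i with t | ⟨⟩
      · rw [hL.cutMatrix_inl hz hz (fun _ _ _ h => h)]
        simp
      · rw [hrow', ho, if_pos rfl, hrow]
        ring
    · exact absurd (by simpa using h.symm) (hcr.2 0)
    · have ho := hz.lastCut_eq_lastCut hoI hqI h.le fun r _ hr => lt_irrefl _ hr.2
      refine (MatEquiv.refl _).congr_right fun i j => ?_
      rcases i with t | ⟨⟩
      · exact (hL.cutMatrix_inl hz hz (fun _ _ _ h => h) t j).symm
      · rw [hrow', hrow, ho]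
        ring

/-- Both diagrams are cut at the two under-passages `t₁ < t₂` of the lower strand in `D'`. The arc
between them does not leave the disc, and the upper strand carries no cut, so both crossings have
the same over-arc. -/
theorem ReidemeisterII.equivCutMatrices {D D' : KnotDiagram} (h : ReidemeisterII D D') :
    EquivCutMatrices D D' := by
  obtain ⟨B, a, b, hL, hD, hD', hcard, hover⟩ := h
  obtain ⟨s₁, t₁, s₂, t₂, hs₁, hs₂, ht₁, ht₂, hst₁, hst₂, htt, hall⟩ : ∃ s₁ t₁ s₂ t₂,
      s₁ ∈ Set.Icc (a 0) (b 0) ∧ s₂ ∈ Set.Icc (a 0) (b 0) ∧ t₁ ∈ Set.Icc (a 1) (b 1) ∧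
      t₂ ∈ Set.Icc (a 1) (b 1) ∧ D'.Cross s₁ t₁ ∧ D'.Cross s₂ t₂ ∧ t₁ < t₂ ∧
      ∀ s ∈ Set.Icc (a 0) (b 0), ∀ t ∈ Set.Icc (a 1) (b 1), D'.Cross s t → t = t₁ ∨ t = t₂ := by
    obtain ⟨⟨s₁, t₁⟩, ⟨s₂, t₂⟩, hne, heq⟩ := Set.ncard_eq_two.1 hcard
    have hall : ∀ s ∈ Set.Icc (a 0) (b 0), ∀ t ∈ Set.Icc (a 1) (b 1), D'.Cross s t →
        t = t₁ ∨ t = t₂ := fun s hs t ht hst => by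
      have : (s, t) ∈ ({(s₁, t₁), (s₂, t₂)} : Set (ℝ × ℝ)) := heq ▸ ⟨hs, ht, hst⟩
      rcases this with h | h
      · exact Or.inl (Prod.ext_iff.1 h).2
      · exact Or.inr (Prod.ext_iff.1 h).2
    have h₁ := heq.symm ▸ Set.mem_insert (s₁, t₁) {(s₂, t₂)}
    have h₂ := heq.symm ▸ Set.mem_insert_of_mem (s₁, t₁) (Set.mem_singleton (s₂, t₂))
    obtain ⟨hs₁, ht₁, hst₁⟩ := h₁
    obtain ⟨hs₂, ht₂, hst₂⟩ := h₂
    rcases lt_trichotomy t₁ t₂ with h | h | h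
    · exact ⟨s₁, t₁, s₂, t₂, hs₁, hs₂, ht₁, ht₂, hst₁, hst₂, h, hall⟩
    -- Two different crossings with the same `t` would give a triple point.
    · simp only at h hst₁ hst₂
      subst h
      obtain ⟨m, hm⟩ := hst₁.eq_add_int hst₂
      have := (hL.strands.disjoint _ _ _ hs₁ _ hs₂ m hm).2
      exact absurd (Prod.ext this rfl) hne
    · exact ⟨s₂, t₂, s₁, t₁, hs₂, hs₁, ht₂, ht₁, hst₂, hst₁, h,
        fun s hs t ht hst => (hall s hs t ht hst).symm⟩
  have hU₁ : t₁ ∈ D'.under :=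
    by_contra fun h => hover s₁ hs₁ ((D'.under_iff _ _ hst₁).2 h)
  have hU₂ : t₂ ∈ D'.under :=
    by_contra fun h => hover s₂ hs₂ ((D'.under_iff _ _ hst₂).2 h)
  have hnot : ∀ i, ∀ t ∈ Set.Icc (a i) (b i), t ∉ D.under := fun i t ht htU => by
    obtain ⟨j, s, hs, hst⟩ := hL.strands.exists_cross ht htU
    exact hD j i s hs t ht hst
  have hmem : ∀ r : Fin 2, ![t₁, t₂] r ∈ Set.Icc (a 1) (b 1) := by
    intro r
    fin_cases r
    · exact ht₁
    · exact ht₂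
  have hz : StrandCuts a b (D.outerUnder B) (fun _ : Fin 2 => 1) ![t₁, t₂] := by
    refine hL.strands.strandCuts hmem ?_
    intro r r' hr
    fin_cases r <;> fin_cases r' <;> simp at hr ⊢ <;> linarith
  have h0 : ∀ s ∈ Set.Icc (a 0) (b 0),
      lastCut (joinCuts (D.outerUnder B) ![t₁, t₂]) s ≠ Sum.inr 0 := fun s hs hl => by
    obtain ⟨m, -, hm⟩ := hz.exists_add_int_mem_Ioc (r' := 1) rfl (by simpa using htt) hl
    have := (hL.strands.disjoint 1 0 _ hm _ hs m rfl).1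
    simp at this
  have h1 : lastCut (joinCuts (D.outerUnder B) ![t₁, t₂]) t₁ ≠ Sum.inr 0 := fun hl => by
    obtain ⟨m, hm, hm'⟩ := hz.exists_add_int_mem_Ioc (r' := 1) rfl (by simpa using htt) hl
    have := (hL.strands.disjoint 1 1 _ hm' _ ht₁ m rfl).2
    rw [this] at hm
    exact lt_irrefl _ hm.1
  have h2 : lastCut (joinCuts (D.outerUnder B) ![t₁, t₂]) t₂ = Sum.inr 0 := by
    refine hz.lastCut_eq_inr (r := 0) htt ht₂.2 fun r _ hr => ?_
    fin_cases r
    · exact lt_irrefl _ hr.1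
    · exact lt_irrefl _ hr.2
  have hss : lastCut (joinCuts (D.outerUnder B) ![t₁, t₂]) s₂ =
      lastCut (joinCuts (D.outerUnder B) ![t₁, t₂]) s₁ := by
    rcases le_total s₁ s₂ with h | h
    · exact hz.lastCut_eq_lastCut hs₁ hs₂ h fun r hr => absurd hr (by simp)
    · exact (hz.lastCut_eq_lastCut hs₂ hs₁ h fun r hr => absurd hr (by simp)).symm
  refine ⟨_, inferInstance, inferInstance, joinCuts (D.outerUnder B) ![t₁, t₂],
    joinCuts (D.outerUnder B) ![t₁, t₂],
    hL.strands.isCutSystem hz fun i t ht htU => absurd htU (hnot i t ht),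
    hL.isCutSystem hz fun i t ht htU => ?_,
    MatEquiv.of_typeII (e₁ := Sum.inr 0) (e₂ := Sum.inr 1) (by simp) h1 (h0 s₁ hs₁)
      (fun j => cutMatrix_of_notMem (hnot 1 t₁ ht₁) j) (fun j => ?_)
      (fun j => cutMatrix_of_cross hz.distinctModInt (i := Sum.inr 0) hU₁ hst₁ j)
      (fun j => ?_) ?_ ?_⟩
  · obtain ⟨j, s, hs, hst⟩ := hL.strands'.exists_cross ht htU
    have hi : i = 1 := by
      by_contra hi
      have : i = 0 := by omega
      exact hover t (this ▸ ht) htU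
    subst hi
    have hj : j = 0 := by
      by_contra hj
      have : j = 1 := by omega
      exact hD' 1 s (this ▸ hs) t ht hst
    subst hj
    rcases hall s hs t ht hst with h | h
    · exact ⟨0, h⟩
    · exact ⟨1, h⟩
  · rw [cutMatrix_of_notMem (i := Sum.inr 1) (hnot 1 t₂ ht₂) j]
    exact congrArg _ (congrArg _ h2)
  · rw [cutMatrix_of_cross hz.distinctModInt (i := Sum.inr 1) hU₂ hst₂ j, hss]
    rw [show joinCuts (D.outerUnder B) ![t₁, t₂] (Sum.inr 1) = t₂ from rfl, h2]
  · rintro (t | r) h₁ h₂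
    · exact hL.cutMatrix_inl_inr hz (r := 0) (r' := 1) rfl htt t
    · fin_cases r <;> simp at h₁ h₂
  · rintro (t | r) h₁ h₂
    · exact funext fun j => hL.cutMatrix_inl hz hz (fun _ _ _ h => h) t j
    · fin_cases r <;> simp at h₁ h₂

end KnotDiagram

/-! ### Type III moves -/

namespace KnotDiagram

/-- If the two crossings on strand `i` coincided, all three strands would pass through one point. -/
theorem ThreeStrands.ne {D : KnotDiagram} {B : Set Plane} {a b : Fin 3 → ℝ}
    {x : Fin 3 → Fin 3 → ℝ} (h : D.ThreeStrands a b x) (hS : D.MeetsInStrands B a b)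
    {i j k : Fin 3} (hij : i ≠ j) (hik : i ≠ k) (hjk : j ≠ k) : x i j ≠ x i k := fun he => by
  have h₁ := h.cross j i hij.symm
  rw [he] at h₁
  obtain ⟨m, hm⟩ := h₁.eq_add_int (h.cross k i hik.symm)
  exact hjk (hS.disjoint _ _ _ (h.mem j i hij.symm) _ (h.mem k i hik.symm) m hm).1

theorem ThreeStrands.eq_of_mem_under {D : KnotDiagram} {B : Set Plane} {a b : Fin 3 → ℝ}
    {x : Fin 3 → Fin 3 → ℝ} (h : D.ThreeStrands a b x) (hS : D.MeetsInStrands B a b)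
    {i : Fin 3} {t : ℝ} (ht : t ∈ Set.Icc (a i) (b i)) (hU : t ∈ D.under) :
    t = x 1 0 ∨ t = x 2 0 ∨ t = x 2 1 := by
  obtain ⟨j, s, hs, hst⟩ := hS.exists_cross ht hU
  obtain ⟨hne, rfl, rfl⟩ := h.eq_of_cross j i s hs t ht hst
  have hji : j < i := by
    refine hne.lt_or_gt.resolve_right fun hlt => ?_
    exact (D.under_iff _ _ hst).1 (h.under i j hlt) hU
  fin_cases i <;> fin_cases j <;> simp at hji ⊢

/-- The hypothesis `h` says that the bottom strand goes under the top one before the middle one; in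
`D'` this order is reversed. The cuts are the three under-passages of the respective diagram. -/
theorem LocalChange.equivCutMatrices_of_threeStrands {D D' : KnotDiagram} {B : Set Plane}
    {a b : Fin 3 → ℝ} {x y : Fin 3 → Fin 3 → ℝ} (hL : LocalChange D D' B a b)
    (hx : D.ThreeStrands a b x) (hy : D'.ThreeStrands a b y)
    (hxy : ∀ i j k, i ≠ j → i ≠ k → j ≠ k → (x i j < x i k ↔ y i k < y i j))
    (h : x 2 0 < x 2 1) : EquivCutMatrices D D' := by
  have h' : y 2 1 < y 2 0 := (hxy 2 0 1 (by simp) (by simp) (by simp)).1 h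
  have hI : ∀ i j, i ≠ j → x i j ∈ Set.Icc (a i) (b i) := hx.mem
  have hI' : ∀ i j, i ≠ j → y i j ∈ Set.Icc (a i) (b i) := hy.mem
  have hx12 : ∀ j, (2 : Fin 3) ≠ j → x 1 0 ≠ x 2 j := fun j hj he => by
    have := (hL.strands.disjoint 1 2 _ (hI 1 0 (by simp)) _ (hI 2 j hj) 0
      (by simpa using he)).1
    simp at this
  have hy12 : ∀ j, (2 : Fin 3) ≠ j → y 1 0 ≠ y 2 j := fun j hj he => by
    have := (hL.strands.disjoint 1 2 _ (hI' 1 0 (by simp)) _ (hI' 2 j hj) 0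
      (by simpa using he)).1
    simp at this
  obtain ⟨z, hzdef⟩ : ∃ z, z = ![x 1 0, x 2 0, x 2 1] := ⟨_, rfl⟩
  -- The cuts on the bottom strand are numbered by position and not by crossing, so that `z` and
  -- `z'` have the same order on each strand.
  obtain ⟨z', hzdef'⟩ : ∃ z, z = ![y 1 0, y 2 1, y 2 0] := ⟨_, rfl⟩
  have hz0 : z 0 = x 1 0 := by simp [hzdef]
  have hz1 : z 1 = x 2 0 := by simp [hzdef]
  have hz2 : z 2 = x 2 1 := by simp [hzdef]
  have hz0' : z' 0 = y 1 0 := by simp [hzdef']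
  have hz1' : z' 1 = y 2 1 := by simp [hzdef']
  have hz2' : z' 2 = y 2 0 := by simp [hzdef']
  have hz : StrandCuts a b (D.outerUnder B) ![1, 2, 2] z := by
    refine hL.strands.strandCuts (fun r => ?_) fun r r' hr => ?_
    · fin_cases r
      · simpa [hz0] using hI 1 0 (by simp)
      · simpa [hz1] using hI 2 0 (by simp)
      · simpa [hz2] using hI 2 1 (by simp)
    · fin_cases r <;> fin_cases r' <;> simp [hzdef, hx12, (hx12 _ _).symm, h.ne, h.ne'] at hr ⊢
  have hz' : StrandCuts a b (D.outerUnder B) ![1, 2, 2] z' := by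
    refine hL.strands.strandCuts (fun r => ?_) fun r r' hr => ?_
    · fin_cases r
      · simpa [hz0'] using hI' 1 0 (by simp)
      · simpa [hz1'] using hI' 2 1 (by simp)
      · simpa [hz2'] using hI' 2 0 (by simp)
    · fin_cases r <;> fin_cases r' <;>
        simp [hzdef', hy12, (hy12 _ _).symm, h'.ne, h'.ne'] at hr ⊢
  have ho : ∀ r r' : Fin 3, ![(1 : Fin 3), 2, 2] r = ![(1 : Fin 3), 2, 2] r' → z r ≤ z r' →
      z' r ≤ z' r' := by
    intro r r' hr hle
    fin_cases r <;> fin_cases r' <;> simp [hzdef, hzdef'] at hr hle ⊢ <;> linarith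
  have hσ1 : ∀ r : Fin 3, ![(1 : Fin 3), 2, 2] r = 1 → r = 0 := by decide
  have hσ2 : ∀ r : Fin 3, ![(1 : Fin 3), 2, 2] r = 2 → r = 1 ∨ r = 2 := by decide
  have hσ0 : ∀ r : Fin 3, ![(1 : Fin 3), 2, 2] r ≠ 0 := by decide
  have hne : ∀ l, l ≠ 2 → ∀ s ∈ Set.Icc (a l) (b l),
      lastCut (joinCuts (D.outerUnder B) z) s ≠ Sum.inr 1 := fun l hl s hs he => by
    obtain ⟨m, -, hm⟩ := hz.exists_add_int_mem_Ioc (r := 1) (r' := 2) rfl (by rwa [hz1, hz2]) he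
    exact hl (hL.strands.disjoint 2 l _ hm _ hs m rfl).1.symm
  have hp₂ : lastCut (joinCuts (D.outerUnder B) z) (x 2 0) ≠ Sum.inr 1 := fun he => by
    obtain ⟨m, hm, hm'⟩ := hz.exists_add_int_mem_Ioc (r := 1) (r' := 2) rfl (by rwa [hz1, hz2]) he
    have := (hL.strands.disjoint 2 2 _ hm' _ (hI 2 0 (by simp)) m rfl).2
    rw [this, hz1] at hm
    exact lt_irrefl _ hm.1
  have hov : lastCut (joinCuts (D.outerUnder B) z) (x 0 2) =
      lastCut (joinCuts (D.outerUnder B) z) (x 0 1) :=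
    hz.lastCut_congr_of_mem hz (fun _ _ _ h => h) (hI 0 1 (by simp)) (hI 0 2 (by simp))
      fun r hr => absurd hr (hσ0 r)
  -- The top strand carries no cut, so it lies in one and the same arc for all its crossings, in
  -- both diagrams.
  have hov' : ∀ j, j ≠ 0 → lastCut (joinCuts (D.outerUnder B) z') (y 0 j) =
      lastCut (joinCuts (D.outerUnder B) z) (x 0 1) := fun j hj =>
    hz.lastCut_congr_of_mem hz' ho (hI 0 1 (by simp)) (hI' 0 j hj.symm)
      fun r hr => absurd hr (hσ0 r)
  have hα' : lastCut (joinCuts (D.outerUnder B) z') (y 1 0) =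
      lastCut (joinCuts (D.outerUnder B) z) (x 1 0) :=
    hz.lastCut_congr_of_mem hz' ho (hI 1 0 (by simp)) (hI' 1 0 (by simp)) fun r hr => by
      rw [hσ1 r hr, hz0, hz0']; simp
  have hβ' : lastCut (joinCuts (D.outerUnder B) z') (y 2 1) =
      lastCut (joinCuts (D.outerUnder B) z) (x 2 0) :=
    hz.lastCut_congr_of_mem hz' ho (hI 2 0 (by simp)) (hI' 2 1 (by simp)) fun r hr => by
      rcases hσ2 r hr with rfl | rfl
      · rw [hz1, hz1']; simp
      · rw [hz2, hz2']; exact iff_of_false h.not_gt h'.not_gt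
  have hγ : lastCut (joinCuts (D.outerUnder B) z) (x 2 1) = Sum.inr 1 := by
    refine hz.lastCut_eq_inr (by rwa [hz1]) (hI 2 1 (by simp)).2 fun r hr => ?_
    rcases hσ2 r hr with rfl | rfl
    · simp
    · simp [hz2]
  have hγ' : lastCut (joinCuts (D.outerUnder B) z') (y 2 0) = Sum.inr 1 := by
    refine hz'.lastCut_eq_inr (by rwa [hz1']) (hI' 2 0 (by simp)).2 fun r hr => ?_
    rcases hσ2 r hr with rfl | rfl
    · simp
    · simp [hz2']
  -- The bottom strand crosses the middle one on opposite sides of the cut `α` in the two diagrams,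
  -- so the over-arcs there are `α` and the arc before `α`, in one order or the other.
  have hww : (lastCut (joinCuts (D.outerUnder B) z) (x 1 2) = Sum.inr 0 ∧
        lastCut (joinCuts (D.outerUnder B) z') (y 1 2) =
          lastCut (joinCuts (D.outerUnder B) z) (x 1 0)) ∨
      (lastCut (joinCuts (D.outerUnder B) z) (x 1 2) =
          lastCut (joinCuts (D.outerUnder B) z) (x 1 0) ∧
        lastCut (joinCuts (D.outerUnder B) z') (y 1 2) = Sum.inr 0) := by
    rcases (hx.ne hL.strands (i := 1) (j := 0) (k := 2)
      (by simp) (by simp) (by simp)).lt_or_gt with hlt | hlt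
    · have hlt' := (hxy 1 0 2 (by simp) (by simp) (by simp)).1 hlt
      refine Or.inl ⟨?_, ?_⟩
      · refine hz.lastCut_eq_inr (by rwa [hz0]) (hI 1 2 (by simp)).2 fun r hr => ?_
        rw [hσ1 r hr]; simp
      · refine hz.lastCut_congr_of_mem hz' ho (hI 1 0 (by simp)) (hI' 1 2 (by simp)) fun r hr => ?_
        rw [hσ1 r hr, hz0, hz0']; simp [hlt'.le]
    · have hlt' := (hxy 1 2 0 (by simp) (by simp) (by simp)).1 hlt
      refine Or.inr ⟨?_, ?_⟩
      · refine hz.lastCut_congr_of_mem hz (fun _ _ _ h => h) (hI 1 0 (by simp)) (hI 1 2 (by simp))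
          fun r hr => ?_
        rw [hσ1 r hr, hz0]; simp [hlt.le]
      · refine hz'.lastCut_eq_inr (by rwa [hz0']) (hI' 1 2 (by simp)).2 fun r hr => ?_
        rw [hσ1 r hr]; simp
  have h10 := hne 1 (by simp) _ (hI 1 0 (by simp))
  have hrow : ∀ (r : Fin 3) (s : ℝ), z r ∈ D.under → D.Cross s (z r) → _ := fun r s =>
    cutMatrix_of_cross (D := D) hz.distinctModInt (i := Sum.inr r) (s := s)
  have hrow' : ∀ (r : Fin 3) (s : ℝ), z' r ∈ D'.under → D'.Cross s (z' r) → _ := fun r s =>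
    cutMatrix_of_cross (D := D') hz'.distinctModInt (i := Sum.inr r) (s := s)
  simp only [joinCuts_inr] at hrow hrow'
  refine ⟨_, inferInstance, inferInstance, joinCuts (D.outerUnder B) z,
    joinCuts (D.outerUnder B) z',
    hL.strands.isCutSystem hz fun i t ht htU => ?_,
    hL.isCutSystem hz' fun i t ht htU => ?_,
    MatEquiv.of_typeIII (α := Sum.inr 0) (β := Sum.inr 1) (γ := Sum.inr 2)
      (w := lastCut (joinCuts (D.outerUnder B) z) (x 1 2))
      (w' := lastCut (joinCuts (D.outerUnder B) z') (y 1 2))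
      (by simp) (by simp) (by simp) h10 hp₂ (hne 0 (by simp) (x 0 1) (hI 0 1 (by simp)))
      (hne 1 (by simp) _ (hI 1 2 (by simp))) ?_ (fun j => ?_)
      (fun j => ?_) (fun j => ?_) (fun j => ?_) (fun j => ?_) (fun j => ?_) (fun j => ?_) ?_ ?_⟩
  · rcases hx.eq_of_mem_under hL.strands ht htU with h | h | h
    · exact ⟨0, h.trans hz0.symm⟩
    · exact ⟨1, h.trans hz1.symm⟩
    · exact ⟨2, h.trans hz2.symm⟩
  · rcases hy.eq_of_mem_under hL.strands' ht htU with h | h | h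
    · exact ⟨0, h.trans hz0'.symm⟩
    · exact ⟨2, h.trans hz2'.symm⟩
    · exact ⟨1, h.trans hz1'.symm⟩
  · rcases hww with hww | hww <;> rw [hww.2]
    · exact h10
    · simp
  · rcases hww with hww | hww <;> rw [hww.1, hww.2]
    ring
  · rw [hrow 0 (x 0 1) (hz0 ▸ hx.under 0 1 (by simp)) (hz0 ▸ hx.cross 0 1 (by simp)), hz0]
  · rw [hrow 1 (x 0 2) (hz1 ▸ hx.under 0 2 (by simp)) (hz1 ▸ hx.cross 0 2 (by simp)), hz1, hov]
  · rw [hrow 2 (x 1 2) (hz2 ▸ hx.under 1 2 (by simp)) (hz2 ▸ hx.cross 1 2 (by simp)), hz2, hγ]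
  · rw [hrow' 0 (y 0 1) (hz0' ▸ hy.under 0 1 (by simp)) (hz0' ▸ hy.cross 0 1 (by simp)), hz0',
      hα', hov' 1 (by simp)]
  · rw [hrow' 1 (y 1 2) (hz1' ▸ hy.under 1 2 (by simp)) (hz1' ▸ hy.cross 1 2 (by simp)), hz1',
      hβ']
  · rw [hrow' 2 (y 0 2) (hz2' ▸ hy.under 0 2 (by simp)) (hz2' ▸ hy.cross 0 2 (by simp)), hz2',
      hγ', hov' 2 (by simp)]
  · rintro (t | r) h₀ h₁ h₂
    · exact hL.cutMatrix_inl_inr hz (r := 1) (r' := 2) rfl (by rwa [hz1, hz2]) t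
    · fin_cases r <;> simp at h₀ h₁ h₂
  · rintro (t | r) h₀ h₁ h₂
    · exact funext fun j => hL.cutMatrix_inl hz hz' ho t j
    · fin_cases r <;> simp at h₀ h₁ h₂

theorem ReidemeisterIII.equivCutMatrices {D D' : KnotDiagram} (h : ReidemeisterIII D D') :
    EquivCutMatrices D D' := by
  obtain ⟨B, a, b, x, y, hL, hx, hy, hxy⟩ := h
  rcases (hx.ne hL.strands (i := 2) (j := 0) (k := 1)
    (by simp) (by simp) (by simp)).lt_or_gt with h | h
  · exact hL.equivCutMatrices_of_threeStrands hx hy hxy h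
  -- In the other order on the bottom strand, `D'` satisfies the inequality required of `D`, so the
  -- roles are exchanged.
  · exact (hL.symm.equivCutMatrices_of_threeStrands hy hx
      (fun i j k hij hik hjk => (hxy i k j hik hij hjk.symm).symm)
      ((hxy 2 1 0 (by simp) (by simp) (by simp)).1 h)).symm

theorem ReidemeisterMove.equivCutMatrices {D D' : KnotDiagram} (h : ReidemeisterMove D D') :
    EquivCutMatrices D D' := by
  rcases h with h | h | h | h | h | h
  · exact h.equivCutMatrices
  · exact h.equivCutMatrices.symm
  · exact h.equivCutMatrices
  · exact h.equivCutMatrices.symm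
  · exact h.equivCutMatrices
  · exact h.equivCutMatrices.symm

end KnotDiagram

/-! ### Invariance under sequences of moves -/

theorem mainTheorem3 (D D' : KnotDiagram)
    (hD : Relation.ReflTransGen KnotDiagram.ReidemeisterMove D D')
    {n n' : ℕ} (M : Matrix (Fin n) (Fin n) ℤ) (M' : Matrix (Fin n') (Fin n') ℤ)
    (hM : D.IsColoringMatrix M) (hM' : D'.IsColoringMatrix M') :
    ElementarilyEquivalent M M' := by
  obtain ⟨c, _, hc, he⟩ := hM'.exists_cutSystem
  refine MatEquiv.elementarilyEquivalent (MatEquiv.trans ?_ he.symm)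
  clear he hM' M'
  -- Each move comes with cut systems of its own, so the induction needs the claim for every cut
  -- system of the current diagram.
  suffices h : ∀ {ι : Type} [Finite ι] [Nonempty ι] {c : ι → ℝ}, D'.IsCutSystem c →
      MatEquiv M (D'.cutMatrix c) from h hc
  clear hc c
  induction hD with
  | refl => exact fun hc => hM.matEquiv_cutMatrix hc
  | tail _ hmove ih =>
    intro ι _ _ d hd
    obtain ⟨κ, _, _, c, c', hc, hc', he⟩ := hmove.equivCutMatrices
    exact ((ih hc).trans he).trans (KnotDiagram.matEquiv_cutMatrix hc' hd)
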